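/- Proposition (Lower tail via the small-ball method). Let $n \ge 1$ and let $\mathcal T \subseteq \mathbb C^{d_1\times d_2}$ be a set of matrices that is invariant under multiplication by unit-modulus complex scalars. Let $(\mathbf a,\mathbf b)$ and $(\mathbf a_1,\mathbf b_1),\dots,(\mathbf a_n,\mathbf b_n)$ be random vectors in $\mathbb C^{d_1}\times\mathbb C^{d_2}$ such that $(\mathbf a_1,\mathbf b_1),\dots,(\mathbf a_n,\mathbf b_n)$ are independent and each has the same distribution as $(\mathbf a,\mathbf b)$, and suppose that both factors are isotropic, i.e. $\mathbb E[\mathbf a\mathbf a^*]=\mathbf I_{d_1}$ and $\mathbb E[\mathbf b\mathbf b^*]=\mathbf I_{d_2}$ (in particular, this holds if the stacked vector $[\mathbf a;\mathbf b]$ is isotropic, $\mathbb E\big[[\mathbf a;\mathbf b][\mathbf a;\mathbf b]^*\big]=\mathbf I_{d_1+d_2}$; $\mathbf a$ and $\mathbf b$ need not be independent of each other). Let $\varepsilon_1,\dots,\varepsilon_n$ be i.i.d. Rademacher random variables ($\pm1$ with probability $1/2$ each), independent of $((\mathbf a_i,\mathbf b_i))_{i=1}^n$. Write $\langle \mathbf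 U,\mathbf V\rangle = \mathrm{Re}\,\mathrm{tr}(\mathbf U^*\mathbf V)$ and let $\|\cdot\|_{\mathrm F}$ be the Frobenius norm. For $\tau>0$ define $$p_\tau(\mathcal T)=\inf_{\mathbf H\in\mathcal T\setminus\{\mathbf 0\}}\mathbb P\left\{|\mathbf a^*\mathbf H\mathbf b|\ge\tau\|\mathbf H\|_{\mathrm F}\right\},\qquad \mathfrak C_n(\mathcal T)=\mathbb E\sup_{\mathbf H\in\mathcal T\setminus\{\mathbf 0\}}\frac1{\sqrt n}\sum_{i=1}^n\frac{\varepsilon_i\langle\mathbf a_i\mathbf b_i^*,\mathbf H\rangle}{\|\mathbf H\|_{\mathrm F}}.$$ Then for every $\tau>0$ and every $\delta\in(0,1)$, with probability at least $1-\delta$, $$\inf_{\mathbf H\in\mathcal T\setminus\{\mathbf 0\}}\frac1n\sum_{i=1}^n\frac{|\mathbf a_i^*\mathbf H\mathbf b_i|}{\|\mathbf H\|_{\mathrm F}}\ \ge\ \tau\,p_\tau(\mathcal T)-\frac{\pi\,\mathfrak C_n(\mathcal T)}{\sqrt n}-\tau\sqrt{\frac{\log(1/\delta)}{n}}.$$ 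-/

import Mathlib

open MeasureTheory ProbabilityTheory
open scoped Matrix

-- Matrices carry the Frobenius norm throughout.
attribute [local instance] Matrix.frobeniusNormedAddCommGroup

namespace RankOneSketch

/-- The real-valued inner product `⟨U, V⟩ = Re tr(U* V)` on complex matrices. -/
noncomputable def realInner {d₁ d₂ : ℕ} (U V : Matrix (Fin d₁) (Fin d₂) ℂ) : ℝ :=
  (Matrix.trace (Uᴴ * V)).re

/-- A complex random vector `v` is isotropic if its entries are square integrable and
`𝔼 [v v*] = I`. -/
def IsIsotropic {Ω : Type*} [MeasurableSpace Ω] (P : Measure Ω) {d : ℕ}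
    (v : Ω → Fin d → ℂ) : Prop :=
  (∀ j, MemLp (fun ω => v ω j) 2 P) ∧
    ∀ j k, ∫ ω, Matrix.vecMulVec (v ω) (star (v ω)) j k ∂P =
      (1 : Matrix (Fin d) (Fin d) ℂ) j k

/-- A real random variable taking each of the values `1` and `-1` with probability `1/2`. -/
def IsRademacher {Ω : Type*} [MeasurableSpace Ω] (P : Measure Ω) (X : Ω → ℝ) : Prop :=
  P {ω | X ω = 1} = 1 / 2 ∧ P {ω | X ω = -1} = 1 / 2

/-- `p_τ(T) = inf_{H ∈ T \ {0}} ℙ (|a* H b| ≥ τ ‖H‖_F)`. -/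
noncomputable def smallBallProb {Ω : Type*} [MeasurableSpace Ω] (P : Measure Ω) {d₁ d₂ : ℕ}
    (a : Ω → Fin d₁ → ℂ) (b : Ω → Fin d₂ → ℂ) (τ : ℝ)
    (T : Set (Matrix (Fin d₁) (Fin d₂) ℂ)) : ℝ :=
  ⨅ H : ↥(T \ {0}), P.real {ω | τ * ‖H.1‖ ≤ ‖star (a ω) ⬝ᵥ (H.1 *ᵥ b ω)‖}

/-- `C_n(T) = 𝔼 sup_{H ∈ T \ {0}} (1/√n) ∑ᵢ εᵢ ⟨aᵢ bᵢ*, H⟩ / ‖H‖_F`. -/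
noncomputable def rademacherComplexity {Ω : Type*} [MeasurableSpace Ω] (P : Measure Ω)
    {d₁ d₂ n : ℕ} (a : Fin n → Ω → Fin d₁ → ℂ) (b : Fin n → Ω → Fin d₂ → ℂ)
    (ε : Fin n → Ω → ℝ) (T : Set (Matrix (Fin d₁) (Fin d₂) ℂ)) : ℝ :=
  ∫ ω, ⨆ H : ↥(T \ {0}), (1 / √(n : ℝ)) *
    ∑ i, ε i ω * realInner (Matrix.vecMulVec (a i ω) (star (b i ω))) H.1 / ‖H.1‖ ∂P

end RankOneSketch

/-! ### A planar law with uniform one-dimensional marginals -/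

namespace RankOneSketch

/-! Normalize to `z = a* H b / (τ ‖H‖)`. The indicator of `1 ≤ ‖z‖` is replaced by a function
`radial` with indicator ≤ `radial z` ≤ `‖z‖` and `radial` ≤ 4/3. The mean of `radial` is then at
least the small-ball probability, its empirical sum is a lower bound for the measured one, and it
remains to control the supremum of mean minus empirical sum.

The constant π comes from reducing complex contraction to real contraction. `radial` is an average
of ridge functions `profile (ζ * z).re`, where ζ is the planar projection of a uniform point of the
sphere in ℝ³. By Archimedes, `(ζ * z).re` is uniform on `(-‖z‖, ‖z‖)`, so the average is radial and
explicit. For fixed ζ, the 2-Lipschitz `profile` allows scalar Ledoux–Talagrand contraction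
(`sum_iSup_contraction`) at cost `2 ‖ζ‖`, and the phase of ζ is absorbed by the invariance of T.
Since `E ‖ζ‖ = π/4`, the averaged cost is π/2, and symmetrization (`integral_iSup_le_rademacher`)
doubles it.

McDiarmid's inequality (`measureReal_ge_le_of_bounded_differences`) gives the deviation term: one
sample moves the supremum by at most 4/3 < √2, so the exponent is at least `log (1/δ)`. All this is
done for finite families (`measureReal_exists_lt_le`); a countable dense subset of `T \ {0}` and
continuity from below give the whole set. -/

open Set Real intervalIntegral in
theorem lintegral_inv_sqrt_one_sub_sq :
    ∫⁻ x : ℝ, ENNReal.ofReal (√(1 - x ^ 2))⁻¹ = ENNReal.ofReal π := by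
  -- `√` vanishes on nonpositive reals and `0⁻¹ = 0`, so the density is zero off the interval
  -- without an indicator.
  have h0 : ∀ x : ℝ, x ∉ Ioc (-1 : ℝ) 1 → (√(1 - x ^ 2))⁻¹ = 0 := by
    intro x hx
    rw [Real.sqrt_eq_zero_of_nonpos, inv_zero]
    by_contra! h
    have := abs_lt.1 ((sq_lt_one_iff_abs_lt_one x).1 (by linarith))
    exact hx ⟨this.1, this.2.le⟩
  have hi := Polynomial.Chebyshev.intervalIntegrable_sqrt_one_sub_sq_inv
  have hv : ∫ x in (-1 : ℝ)..1, (√(1 - x ^ 2))⁻¹ = π := by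
    have h := Polynomial.Chebyshev.integral_measureT (fun _ => 1)
    rw [Polynomial.Chebyshev.integral_measureT_eq_integral_cos] at h
    simpa using h.symm
  rw [intervalIntegrable_iff, uIoc_of_le (by norm_num)] at hi
  simp only [Real.sqrt_inv] at hi
  rw [← setLIntegral_eq_of_support_subset (s := Ioc (-1 : ℝ) 1),
    ← ofReal_integral_eq_lintegral_ofReal hi (by filter_upwards with x; positivity),
    ← integral_of_le (by norm_num), hv]
  intro x hx
  by_contra h
  simp [h0 x h] at hx

open Set Real intervalIntegral in
theorem lintegral_inv_sqrt_sq_sub_sq {x : ℝ} :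
    -- Rescaling `y` by the half-chord `√(1 - x ^ 2)` multiplies the integrand and the Lebesgue
    -- measure by the same factor, which cancels. That the answer does not depend on `x` inside the
    -- interval is the content of the hat-box theorem.
    ∫⁻ y : ℝ, ENNReal.ofReal (√(1 - (x ^ 2 + y ^ 2)))⁻¹ =
      (Ioo (-1 : ℝ) 1).indicator (fun _ => ENNReal.ofReal π) x := by
  by_cases hx : x ∈ Ioo (-1 : ℝ) 1
  · rw [indicator_of_mem hx]
    have hpos : 0 < 1 - x ^ 2 := by nlinarith [hx.1, hx.2]
    set c := √(1 - x ^ 2) with hc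
    have hcpos : 0 < c := Real.sqrt_pos.2 hpos
    have hcc : c ^ 2 = 1 - x ^ 2 := Real.sq_sqrt hpos.le
    have h : ∫⁻ y : ℝ, ENNReal.ofReal (√(1 - (x ^ 2 + (c * y) ^ 2)))⁻¹ =
        ENNReal.ofReal |c⁻¹| * ∫⁻ y : ℝ, ENNReal.ofReal (√(1 - (x ^ 2 + y ^ 2)))⁻¹ := by
      rw [← smul_eq_mul, ← lintegral_smul_measure, ← Real.map_volume_mul_left hcpos.ne',
        lintegral_map (by fun_prop) (by fun_prop)]
    have h2 : ∀ y : ℝ, ENNReal.ofReal (√(1 - (x ^ 2 + (c * y) ^ 2)))⁻¹ =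
        ENNReal.ofReal c⁻¹ * ENNReal.ofReal (√(1 - y ^ 2))⁻¹ := by
      intro y
      rw [← ENNReal.ofReal_mul (by positivity), ← mul_inv, ← Real.sqrt_sq hcpos.le,
        ← Real.sqrt_mul (by positivity), Real.sqrt_sq hcpos.le, mul_pow, hcc]
      ring_nf
    simp_rw [h2] at h
    rw [lintegral_const_mul _ (by fun_prop), lintegral_inv_sqrt_one_sub_sq,
      abs_of_pos (inv_pos.2 hcpos)] at h
    refine ((ENNReal.mul_right_inj ?_ ENNReal.ofReal_ne_top).1 h).symm
    simpa using hcpos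
  · rw [indicator_of_notMem hx]
    have : ∀ y : ℝ, ENNReal.ofReal (√(1 - (x ^ 2 + y ^ 2)))⁻¹ = 0 := by
      intro y
      have : 1 ≤ x ^ 2 := by
        by_contra! h
        exact hx (abs_lt.1 ((sq_lt_one_iff_abs_lt_one x).1 h))
      rw [Real.sqrt_eq_zero_of_nonpos (by nlinarith [sq_nonneg y])]
      simp
    simp [this]

/-- The law of the first two coordinates, viewed as a complex number, of a uniformly
distributed point of the unit sphere of `ℝ³`. -/
noncomputable def sphereProj : Measure ℂ :=
  ENNReal.ofReal (2 * Real.pi)⁻¹ •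
    volume.withDensity (fun ζ : ℂ => ENNReal.ofReal (√(1 - ‖ζ‖ ^ 2))⁻¹)

theorem lintegral_sphereProj {F : ℂ → ENNReal} (hF : Measurable F) :
    ∫⁻ ζ, F ζ ∂sphereProj = ENNReal.ofReal (2 * Real.pi)⁻¹ *
      ∫⁻ ζ, ENNReal.ofReal (√(1 - ‖ζ‖ ^ 2))⁻¹ * F ζ := by
  rw [sphereProj, lintegral_smul_measure, lintegral_withDensity_eq_lintegral_mul _ (by fun_prop) hF]
  rfl

/-- Archimedes' hat-box theorem. -/
theorem lintegral_sphereProj_re {F : ℝ → ENNReal} (hF : Measurable F) (z : ℂ) :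
    ∫⁻ ζ, F (ζ * z).re ∂sphereProj =
      ENNReal.ofReal (1 / 2) * ∫⁻ x in Set.Ioo (-1 : ℝ) 1, F (‖z‖ * x) := by
  obtain ⟨u, hu, hz⟩ : ∃ u : ℂ, ‖u‖ = 1 ∧ z = ‖z‖ * u := by
    rcases eq_or_ne z 0 with rfl | h
    · exact ⟨1, by simp, by simp⟩
    · exact ⟨z / ‖z‖, by simp [h], by field_simp [norm_ne_zero_iff.2 h]⟩
  rw [lintegral_sphereProj (by fun_prop)]
  -- The density is radial, so rotating ζ by the phase of `z` reduces to real nonnegative `z`.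
  have hrot : MeasurePreserving (fun ζ : ℂ => ζ * u) := by
    obtain ⟨v, rfl⟩ : ∃ v : Circle, (v : ℂ) = u :=
      ⟨⟨u, mem_sphere_zero_iff_norm.2 hu⟩, rfl⟩
    convert (rotation v).measurePreserving using 2 with ζ
    rw [rotation_apply, mul_comm]
  have h1 : ∫⁻ ζ : ℂ, ENNReal.ofReal (√(1 - ‖ζ‖ ^ 2))⁻¹ * F (ζ * z).re =
      ∫⁻ ζ : ℂ, ENNReal.ofReal (√(1 - ‖ζ‖ ^ 2))⁻¹ * F (‖z‖ * ζ.re) := by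
    conv_rhs => rw [← hrot.lintegral_comp (by fun_prop)]
    refine lintegral_congr fun ζ => ?_
    rw [norm_mul, hu, mul_one]
    congr 2
    conv_lhs => rw [hz]
    rw [mul_left_comm, Complex.re_ofReal_mul]
  rw [h1, ← Complex.volume_preserving_equiv_real_prod.symm.lintegral_comp (by fun_prop),
    Measure.volume_eq_prod, lintegral_prod _ (by fun_prop)]
  have h2 : ∀ x y : ℝ, ‖Complex.measurableEquivRealProd.symm (x, y)‖ ^ 2 = x ^ 2 + y ^ 2 := by
    intro x y
    rw [Complex.sq_norm, Complex.normSq_apply]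
    simp [Complex.measurableEquivRealProd, sq]
  have h3 : ∀ x y : ℝ, (Complex.measurableEquivRealProd.symm (x, y)).re = x := by
    intro x y; simp [Complex.measurableEquivRealProd]
  simp_rw [h2, h3]
  have h4 : ∀ x : ℝ, ∫⁻ y : ℝ, ENNReal.ofReal (√(1 - (x ^ 2 + y ^ 2)))⁻¹ * F (‖z‖ * x) =
      (Set.Ioo (-1 : ℝ) 1).indicator (fun x => ENNReal.ofReal Real.pi * F (‖z‖ * x)) x := by
    intro x
    rw [lintegral_mul_const _ (by fun_prop), lintegral_inv_sqrt_sq_sub_sq]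
    by_cases hx : x ∈ Set.Ioo (-1 : ℝ) 1
    · simp [hx]
    · simp [hx]
  simp_rw [h4]
  rw [lintegral_indicator measurableSet_Ioo, lintegral_const_mul _ (by fun_prop), ← mul_assoc,
    ← ENNReal.ofReal_mul (by positivity)]
  congr 2
  field_simp

instance : IsProbabilityMeasure sphereProj where
  measure_univ := by
    have := lintegral_sphereProj_re (F := fun _ => 1) measurable_const 0
    rw [lintegral_one] at this
    rw [this]
    simp only [lintegral_const, Measure.restrict_apply MeasurableSet.univ, Set.univ_inter,
      Real.volume_Ioo, one_mul]
    rw [← ENNReal.ofReal_mul (by norm_num)]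
    norm_num

open Set Real intervalIntegral in
theorem lintegral_sq_mul_inv_sqrt :
    ∫⁻ r in Ioi (0 : ℝ), ENNReal.ofReal (r ^ 2 * (√(1 - r ^ 2))⁻¹) = ENNReal.ofReal (π / 4) := by
  have h0 : ∀ x : ℝ, x ∉ Ioc (-1 : ℝ) 1 → (√(1 - x ^ 2))⁻¹ = 0 := by
    intro x hx
    rw [Real.sqrt_eq_zero_of_nonpos, inv_zero]
    by_contra! h
    have := abs_lt.1 ((sq_lt_one_iff_abs_lt_one x).1 (by linarith))
    exact hx ⟨this.1, this.2.le⟩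
  have hv : ∫ x in (-1 : ℝ)..1, x ^ 2 * (√(1 - x ^ 2))⁻¹ = π / 2 := by
    have h := Polynomial.Chebyshev.integral_measureT (fun x => x ^ 2)
    rw [Polynomial.Chebyshev.integral_measureT_eq_integral_cos, integral_cos_sq] at h
    simpa using h.symm
  have hi := Polynomial.Chebyshev.intervalIntegrable_sqrt_one_sub_sq_inv.continuousOn_mul
    (show ContinuousOn (fun x : ℝ => x ^ 2) (uIcc (-1) 1) by fun_prop)
  rw [intervalIntegrable_iff, uIoc_of_le (by norm_num)] at hi
  simp only [Real.sqrt_inv] at hi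
  have hs : ∀ x ∉ Ioc (-1 : ℝ) 1, x ^ 2 * (√(1 - x ^ 2))⁻¹ = 0 := fun x hx => by simp [h0 x hx]
  have hi' : Integrable (fun x : ℝ => x ^ 2 * (√(1 - x ^ 2))⁻¹) :=
    hi.integrable_of_forall_notMem_eq_zero hs
  rw [integral_of_le (by norm_num), setIntegral_eq_integral_of_forall_compl_eq_zero hs] at hv
  have habs := integral_comp_abs (f := fun x : ℝ => x ^ 2 * (√(1 - x ^ 2))⁻¹)
  simp only [sq_abs] at habs
  rw [← ofReal_integral_eq_lintegral_ofReal hi'.integrableOn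
    (by filter_upwards with x; positivity)]
  congr 1
  linarith

/-- In polar coordinates the Jacobian and `‖ζ‖` each supply a factor `r`, leaving the radial
integral above. This first moment fixes the constant π of the theorem, as 2 · 2 · π/4. -/
theorem lintegral_norm_sphereProj :
    ∫⁻ ζ, ENNReal.ofReal ‖ζ‖ ∂sphereProj = ENNReal.ofReal (Real.pi / 4) := by
  rw [lintegral_sphereProj (by fun_prop), ← Complex.lintegral_comp_polarCoord_symm]
  have : ∀ p ∈ polarCoord.target, ENNReal.ofReal p.1 • (ENNReal.ofReal
      (√(1 - ‖Complex.polarCoord.symm p‖ ^ 2))⁻¹ * ENNReal.ofReal ‖Complex.polarCoord.symm p‖) =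
      ENNReal.ofReal (p.1 ^ 2 * (√(1 - p.1 ^ 2))⁻¹) := by
    intro p hp
    have hp0 : 0 < p.1 := hp.1
    rw [Complex.norm_polarCoord_symm, abs_of_pos hp0, smul_eq_mul,
      ← ENNReal.ofReal_mul (by positivity), ← ENNReal.ofReal_mul (by positivity)]
    ring_nf
  rw [setLIntegral_congr_fun polarCoord.open_target.measurableSet this, polarCoord_target,
    Measure.volume_eq_prod, ← Measure.prod_restrict, lintegral_prod _ (by fun_prop)]
  simp only [lintegral_const, Measure.restrict_apply MeasurableSet.univ, Set.univ_inter,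
      Real.volume_Ioo]
  rw [lintegral_mul_const _ (by fun_prop), lintegral_sq_mul_inv_sqrt,
    ← ENNReal.ofReal_mul (by positivity), ← ENNReal.ofReal_mul (by positivity)]
  congr 1
  field_simp
  ring

theorem integrable_norm_sphereProj : Integrable (fun ζ : ℂ => ‖ζ‖) sphereProj := by
  refine ⟨by fun_prop, ?_⟩
  rw [hasFiniteIntegral_iff_ofReal (by filter_upwards with ζ; positivity),
    lintegral_norm_sphereProj]
  exact ENNReal.ofReal_lt_top

theorem integral_norm_sphereProj : ∫ ζ, ‖ζ‖ ∂sphereProj = Real.pi / 4 := by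
  rw [integral_eq_lintegral_of_nonneg_ae (by filter_upwards with ζ; positivity) (by fun_prop),
    lintegral_norm_sphereProj, ENNReal.toReal_ofReal (by positivity)]

/-! ### The radial surrogate for the small-ball indicator -/

/-- A `2`-Lipschitz ridge profile. -/
noncomputable def profile (x : ℝ) : ℝ := min (2 * |x|) (max (4 - 2 * |x|) 1)

theorem profile_nonneg (x : ℝ) : 0 ≤ profile x :=
  le_min (by positivity) (le_max_of_le_right zero_le_one)

theorem profile_le (x : ℝ) : profile x ≤ 2 * |x| := min_le_left _ _

theorem profile_abs (x : ℝ) : profile |x| = profile x := by simp [profile]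

@[fun_prop]
theorem continuous_profile : Continuous profile := by unfold profile; fun_prop

theorem profile_le_two (x : ℝ) : profile x ≤ 2 := by
  unfold profile
  rcases le_total |x| 1 with h | h
  · exact min_le_of_left_le (by linarith)
  · exact min_le_of_right_le (max_le (by linarith) one_le_two)

theorem abs_profile_sub_le (x y : ℝ) : |profile x - profile y| ≤ 2 * |x - y| := by
  have h := abs_abs_sub_abs_le x y
  refine (abs_min_sub_min_le_max _ _ _ _).trans (max_le ?_ ((abs_max_sub_max_le_max _ _ _ _).trans
    (max_le ?_ ?_)))
  · rw [← mul_sub, abs_mul]; simpa using h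
  · rw [show 4 - 2 * |x| - (4 - 2 * |y|) = (-2) * (|x| - |y|) by ring, abs_mul]; simpa using h
  · simp

/-- The average of the ridge functions `ζ ↦ profile (Re (ζ z))`, a radial smoothing of
`min ‖z‖ 1`. -/
noncomputable def radial (z : ℂ) : ℝ := ∫ ζ, profile (ζ * z).re ∂sphereProj

theorem integrable_profile (z : ℂ) : Integrable (fun ζ => profile (ζ * z).re) sphereProj :=
  .of_bound (by fun_prop) 2 (by
    filter_upwards with ζ
    rw [Real.norm_of_nonneg (profile_nonneg _)]
    exact profile_le_two _)

theorem measurable_radial : Measurable radial := by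
  have : StronglyMeasurable (fun p : ℂ × ℂ => profile (p.2 * p.1).re) :=
    (Continuous.measurable (by fun_prop)).stronglyMeasurable
  exact (this.integral_prod_right (ν := sphereProj)).measurable

/-- The hat-box theorem makes `(ζ * z).re` uniform on a symmetric interval; evenness of `profile`
folds it onto its positive half. -/
theorem radial_eq (z : ℂ) : radial z = ∫ x in (0 : ℝ)..1, profile (‖z‖ * x) := by
  rw [radial, integral_eq_lintegral_of_nonneg_ae
    (by filter_upwards with ζ using profile_nonneg _) (by fun_prop),
    lintegral_sphereProj_re (F := fun x => ENNReal.ofReal (profile x)) (by fun_prop),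
    ← ofReal_integral_eq_lintegral_ofReal _ (by filter_upwards with ζ using profile_nonneg _),
    ← ENNReal.ofReal_mul (by norm_num), ENNReal.toReal_ofReal,
    ← integral_Ioc_eq_integral_Ioo, ← intervalIntegral.integral_of_le (by norm_num)]
  · have hc : Continuous (fun x => profile (‖z‖ * x)) := by fun_prop
    rw [← intervalIntegral.integral_add_adjacent_intervals (b := 0) (hc.intervalIntegrable _ _)
      (hc.intervalIntegrable _ _)]
    have h := intervalIntegral.integral_comp_neg (a := 0) (b := 1) (fun x => profile (‖z‖ * x))
    have h' : ∀ x, profile (‖z‖ * -x) = profile (‖z‖ * x) := fun x => by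
      rw [← profile_abs, mul_neg, abs_neg, profile_abs]
    simp_rw [h', neg_zero] at h
    linarith
  · exact mul_nonneg (by norm_num) (integral_nonneg fun _ => profile_nonneg _)
  · exact (Continuous.integrableOn_Icc (by fun_prop)).mono_set Set.Ioo_subset_Icc_self

theorem radial_nonneg (z : ℂ) : 0 ≤ radial z := integral_nonneg fun _ => profile_nonneg _

theorem radial_le_norm (z : ℂ) : radial z ≤ ‖z‖ := by
  rw [radial_eq]
  calc ∫ x in (0 : ℝ)..1, profile (‖z‖ * x) ≤ ∫ x in (0 : ℝ)..1, 2 * ‖z‖ * x := by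
        refine intervalIntegral.integral_mono_on zero_le_one
          (Continuous.intervalIntegrable (by fun_prop) _ _)
          (Continuous.intervalIntegrable (by fun_prop) _ _) fun x hx => ?_
        have := profile_le (‖z‖ * x)
        rwa [abs_of_nonneg (mul_nonneg (norm_nonneg z) hx.1), ← mul_assoc] at this
    _ = ‖z‖ := by
        rw [intervalIntegral.integral_const_mul, integral_id]; ring

/-- This identity dictates `profile`: it is the derivative of `r * radial` in `r = ‖z‖`. For `min r
1` the derivative would be `2 r`, then 1, with a jump at `r = 1`; `profile` descends from 2 to 1
with slope -2 on `[1, 3/2]` to remain 2-Lipschitz. -/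
theorem norm_mul_radial (z : ℂ) : ‖z‖ * radial z = ∫ x in (0 : ℝ)..‖z‖, profile x := by
  rw [radial_eq, intervalIntegral.mul_integral_comp_mul_left]
  simp

theorem integral_profile_zero_one : ∫ x in (0 : ℝ)..1, profile x = 1 := by
  have : ∀ x ∈ Set.uIcc (0 : ℝ) 1, profile x = 2 * x := by
    intro x hx
    rw [Set.uIcc_of_le zero_le_one] at hx
    rw [profile, abs_of_nonneg hx.1, min_eq_left]
    rcases le_total x (1 / 2) with h | h
    · exact le_max_of_le_right (by linarith)
    · exact le_max_of_le_left (by linarith [hx.2])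
  rw [intervalIntegral.integral_congr this, intervalIntegral.integral_const_mul, integral_id]
  norm_num

theorem one_le_profile {x : ℝ} (hx : 1 ≤ x) : 1 ≤ profile x :=
  le_min (by rw [abs_of_nonneg (by linarith)]; linarith) (le_max_right _ _)

theorem profile_eq_one {x : ℝ} (hx : 3 / 2 ≤ x) : profile x = 1 := by
  rw [profile, abs_of_nonneg (by linarith), max_eq_right (by linarith), min_eq_right (by linarith)]

theorem intervalIntegrable_profile (a b : ℝ) : IntervalIntegrable profile volume a b :=
  continuous_profile.intervalIntegrable _ _

theorem one_le_radial {z : ℂ} (hz : 1 ≤ ‖z‖) : 1 ≤ radial z := by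
  have h := norm_mul_radial z
  rw [← intervalIntegral.integral_add_adjacent_intervals (intervalIntegrable_profile 0 1)
    (intervalIntegrable_profile 1 _), integral_profile_zero_one] at h
  have h1 : ∫ x in (1 : ℝ)..‖z‖, (1 : ℝ) ≤ ∫ x in (1 : ℝ)..‖z‖, profile x :=
    intervalIntegral.integral_mono_on hz (by simp) (intervalIntegrable_profile _ _)
      fun x hx => one_le_profile hx.1
  rw [intervalIntegral.integral_const, smul_eq_mul, mul_one] at h1
  nlinarith

theorem integral_profile_le {a b : ℝ} (hab : a ≤ b) : ∫ x in a..b, profile x ≤ (b - a) * 2 := by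
  have h1 : ∫ x in a..b, profile x ≤ ∫ x in a..b, (2 : ℝ) :=
    intervalIntegral.integral_mono_on hab (intervalIntegrable_profile _ _) (by simp)
      fun x _ => profile_le_two x
  simpa using h1

/-- Overshooting 1 is the price of continuity; any bound up to √2 would suffice for the
concentration step. Between 4/3 and 3/2, `r * radial` is at most `2 r - 1`, and beyond 3/2 at most
`r + 1/2`; both are below `4 r / 3` on their ranges, with equality at 3/2. -/
theorem radial_le (z : ℂ) : radial z ≤ 4 / 3 := by
  rcases le_total ‖z‖ (4 / 3) with h43 | h43
  · exact (radial_le_norm z).trans h43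
  have h := norm_mul_radial z
  rw [← intervalIntegral.integral_add_adjacent_intervals (intervalIntegrable_profile 0 1)
    (intervalIntegrable_profile 1 _), integral_profile_zero_one] at h
  rcases le_total ‖z‖ (3 / 2) with h32 | h32
  · have := integral_profile_le (show 1 ≤ ‖z‖ by linarith)
    nlinarith
  · rw [← intervalIntegral.integral_add_adjacent_intervals (intervalIntegrable_profile 1 (3 / 2))
      (intervalIntegrable_profile (3 / 2) _)] at h
    have h1 := integral_profile_le (show (1 : ℝ) ≤ 3 / 2 by norm_num)
    have h2 : ∫ x in (3 / 2 : ℝ)..‖z‖, profile x = ‖z‖ - 3 / 2 := by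
      rw [intervalIntegral.integral_congr (g := fun _ => 1)]
      · simp
      · intro x hx
        rw [Set.uIcc_of_le h32] at hx
        exact profile_eq_one hx.1
    nlinarith

/-! ### Concentration under bounded differences -/

section BoundedDifferences

variable {W : Type*} [MeasurableSpace W] {μ : Measure W} [IsProbabilityMeasure μ]

theorem integrable_of_measurable_of_abs_le {X : Type*} [MeasurableSpace X] {ν : Measure X}
    [IsFiniteMeasure ν] {F : X → ℝ} (hF : Measurable F) {M : ℝ} (hM : ∀ x, |F x| ≤ M) :
    Integrable F ν :=
  .of_bound hF.aestronglyMeasurable M (.of_forall hM)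

theorem integral_exp_sub_integral_le {X : W → ℝ} (hX : Measurable X) {c M : ℝ}
    (hM : ∀ x, |X x| ≤ M) (hc : ∀ x y, X x - X y ≤ c) (t : ℝ) :
    ∫ x, Real.exp (t * (X x - ∫ y, X y ∂μ)) ∂μ ≤ Real.exp (t ^ 2 * c ^ 2 / 8) := by
  have hne : Nonempty W := μ.nonempty_of_neZero
  have hbdd : BddBelow (Set.range X) := ⟨-M, by rintro _ ⟨x, rfl⟩; exact (abs_le.1 (hM x)).1⟩
  -- Oscillation at most `c` places `X` in the interval of length `c` starting at its infimum, where
  -- Hoeffding's lemma applies.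
  have h := (hasSubgaussianMGF_of_mem_Icc (μ := μ) (X := X) (a := ⨅ x, X x)
    (b := (⨅ x, X x) + c) hX.aemeasurable (.of_forall fun x => ⟨ciInf_le hbdd x, by
      have : X x - c ≤ ⨅ y, X y := le_ciInf fun y => by linarith [hc x y]
      linarith⟩)).mgf_le t
  refine h.trans (Real.exp_le_exp.2 (le_of_eq ?_))
  simp only [add_sub_cancel_left, NNReal.coe_pow, NNReal.coe_div, coe_nnnorm, Real.norm_eq_abs,
    NNReal.coe_ofNat, div_pow, sq_abs]
  ring

theorem piFinSuccAbove_zero_symm (n : ℕ) (p : W × (Fin n → W)) :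
    (MeasurableEquiv.piFinSuccAbove (fun _ : Fin (n + 1) => W) 0).symm p =
      (Fin.cons p.1 p.2 : Fin (n + 1) → W) := by
  simp [MeasurableEquiv.piFinSuccAbove_symm_apply, Fin.insertNthEquiv, Fin.insertNth_zero']

theorem measurable_fin_cons (n : ℕ) :
    Measurable fun p : W × (Fin n → W) => (Fin.cons p.1 p.2 : Fin (n + 1) → W) := by
  convert (MeasurableEquiv.piFinSuccAbove (fun _ : Fin (n + 1) => W) 0).symm.measurable using 2
  exact (piFinSuccAbove_zero_symm n _).symm

theorem integral_pi_succ {n : ℕ} (F : (Fin (n + 1) → W) → ℝ)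
    (hF : Integrable F (Measure.pi fun _ => μ)) :
    ∫ x, F x ∂(Measure.pi fun _ => μ) =
      ∫ y, ∫ x, F (Fin.cons x y) ∂μ ∂(Measure.pi fun _ : Fin n => μ) := by
  have he := (measurePreserving_piFinSuccAbove (fun _ : Fin (n + 1) => μ) 0).symm
  rw [← he.integral_comp', integral_prod_symm]
  · simp_rw [piFinSuccAbove_zero_symm]
  · exact (he.integrable_comp_emb (MeasurableEquiv.measurableEmbedding _)).2 hF

/-- Induction by integrating out the first coordinate. The partial mean `G` inherits the bounds, and
for fixed remaining coordinates `F - G` is centred with oscillation at most `c`, so Hoeffding's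
lemma contributes one factor per coordinate. -/
theorem mgf_le_of_bounded_differences {n : ℕ} {F : (Fin n → W) → ℝ} (hF : Measurable F)
    {c M : ℝ} (hM : ∀ x, |F x| ≤ M)
    (hc : ∀ x i v, F x - F (Function.update x i v) ≤ c) (t : ℝ) :
    ∫ x, Real.exp (t * (F x - ∫ y, F y ∂(Measure.pi fun _ => μ))) ∂(Measure.pi fun _ => μ) ≤
      Real.exp (n * (t ^ 2 * c ^ 2 / 8)) := by
  induction n with
  | zero =>
    have : ∀ x : Fin 0 → W, F x = F Fin.elim0 := fun x => congrArg F (Subsingleton.elim _ _)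
    simp [this]
  | succ n ih =>
    set G : (Fin n → W) → ℝ := fun y => ∫ x, F (Fin.cons x y) ∂μ with hG
    have hcons : Measurable fun p : W × (Fin n → W) => (Fin.cons p.1 p.2 : Fin (n + 1) → W) :=
      measurable_fin_cons n
    have hGm : Measurable G :=
      ((hF.comp hcons).stronglyMeasurable.integral_prod_left').measurable
    have hFi : ∀ y, Integrable (fun x => F (Fin.cons x y)) μ := fun y =>
      integrable_of_measurable_of_abs_le (hF.comp (hcons.comp measurable_prodMk_right))
        fun x => hM _
    have hGM : ∀ y, |G y| ≤ M := fun y => by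
      have := norm_integral_le_of_norm_le_const (μ := μ) (f := fun x => F (Fin.cons x y)) (C := M)
        (.of_forall fun x => hM _)
      simpa using this
    have hGc : ∀ y i v, G y - G (Function.update y i v) ≤ c := by
      intro y i v
      rw [hG]
      simp only
      rw [← integral_sub (hFi _) (hFi _)]
      refine (integral_mono ((hFi _).sub (hFi _)) (integrable_const c) fun x => ?_).trans_eq
        (by simp)
      have := hc (Fin.cons x y) i.succ v
      rwa [← Fin.cons_update] at this
    have hEG : ∫ x, F x ∂(Measure.pi fun _ => μ) = ∫ y, G y ∂(Measure.pi fun _ => μ) :=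
      integral_pi_succ F (integrable_of_measurable_of_abs_le hF hM)
    set E := ∫ y, G y ∂(Measure.pi fun _ => μ) with hE
    have hEM : |E| ≤ M := by
      have := norm_integral_le_of_norm_le_const (μ := Measure.pi fun _ : Fin n => μ) (f := G)
        (C := M) (.of_forall fun x => hGM _)
      simpa using this
    have hexp : ∀ {X : Type _} [MeasurableSpace X] {ν : Measure X} [IsFiniteMeasure ν]
        {H : X → ℝ} (_ : Measurable H) (_ : ∀ x, |H x| ≤ M),
        Integrable (fun x => Real.exp (t * (H x - E))) ν := by
      intro X _ ν _ H hH hHM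
      refine .of_bound (by fun_prop) (Real.exp (|t| * (2 * M))) (.of_forall fun x => ?_)
      rw [Real.norm_of_nonneg (Real.exp_nonneg _), Real.exp_le_exp]
      refine (le_abs_self _).trans ?_
      rw [abs_mul]
      have := (abs_sub (H x) E).trans (add_le_add (hHM x) hEM)
      exact mul_le_mul_of_nonneg_left (by linarith) (abs_nonneg t)
    rw [hEG, integral_pi_succ _ (hexp hF hM)]
    calc ∫ y, ∫ x, Real.exp (t * (F (Fin.cons x y) - E)) ∂μ ∂(Measure.pi fun _ => μ)
        ≤ ∫ y, Real.exp (t ^ 2 * c ^ 2 / 8) * Real.exp (t * (G y - E))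
            ∂(Measure.pi fun _ => μ) := by
          refine integral_mono_of_nonneg (.of_forall fun y => integral_nonneg fun x =>
            Real.exp_nonneg _) ((hexp hGm hGM).const_mul _) (.of_forall fun y => ?_)
          have h1 : ∀ x, Real.exp (t * (F (Fin.cons x y) - E)) =
              Real.exp (t * (F (Fin.cons x y) - G y)) * Real.exp (t * (G y - E)) := fun x => by
            rw [← Real.exp_add]; ring_nf
          simp only [h1]
          rw [integral_mul_const]
          refine mul_le_mul_of_nonneg_right ?_ (Real.exp_nonneg _)
          refine integral_exp_sub_integral_le
            (hF.comp (hcons.comp measurable_prodMk_right)) (fun x => hM _) (fun x x' => ?_) t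
          have := hc (Fin.cons x y) 0 x'
          rwa [Fin.update_cons_zero] at this
      _ ≤ Real.exp (t ^ 2 * c ^ 2 / 8) * Real.exp (n * (t ^ 2 * c ^ 2 / 8)) := by
          rw [integral_const_mul]
          exact mul_le_mul_of_nonneg_left (ih hGm hGM hGc) (Real.exp_nonneg _)
      _ = Real.exp ((n + 1 : ℕ) * (t ^ 2 * c ^ 2 / 8)) := by
          rw [← Real.exp_add]; push_cast; ring_nf

/-- McDiarmid's inequality. -/
theorem measureReal_ge_le_of_bounded_differences {n : ℕ} {F : (Fin n → W) → ℝ}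
    (hF : Measurable F) {c M : ℝ} (hM : ∀ x, |F x| ≤ M)
    (hc : ∀ x i v, F x - F (Function.update x i v) ≤ c) {s : ℝ} (hs : 0 ≤ s) :
    (Measure.pi fun _ => μ).real {x | s ≤ F x - ∫ y, F y ∂(Measure.pi fun _ => μ)} ≤
      Real.exp (-(2 * s ^ 2) / (n * c ^ 2)) := by
  set E := ∫ y, F y ∂(Measure.pi fun _ : Fin n => μ) with hE
  have hsub : HasSubgaussianMGF (fun x => F x - E) (n * c ^ 2 / 4).toNNReal
      (Measure.pi fun _ : Fin n => μ) := by
    refine ⟨fun t => ?_, fun t => ?_⟩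
    · refine .of_bound (by fun_prop) (Real.exp (|t| * (M + |E|))) (.of_forall fun x => ?_)
      rw [Real.norm_of_nonneg (Real.exp_nonneg _), Real.exp_le_exp]
      refine (le_abs_self _).trans ?_
      rw [abs_mul]
      exact mul_le_mul_of_nonneg_left ((abs_sub _ _).trans (by linarith [hM x])) (abs_nonneg t)
    · refine (mgf_le_of_bounded_differences hF hM hc t).trans (Real.exp_le_exp.2 (le_of_eq ?_))
      rw [Real.coe_toNNReal _ (by positivity)]
      ring
  refine (hsub.measure_ge_le hs).trans (Real.exp_le_exp.2 (le_of_eq ?_))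
  rw [Real.coe_toNNReal _ (by positivity)]
  rw [show 2 * (n * c ^ 2 / 4) = (n * c ^ 2) / 2 by ring, div_div_eq_mul_div]
  ring_nf

end BoundedDifferences

/-! ### Contraction and symmetrization over finite families -/

section Rademacher

/-- The real number `1` or `-1` encoded by a Boolean. -/
def sign (b : Bool) : ℝ := bif b then 1 else -1

@[simp] theorem sign_true : sign true = 1 := rfl

@[simp] theorem sign_false : sign false = -1 := rfl

theorem abs_sign (b : Bool) : |sign b| = 1 := by cases b <;> simp

variable {ι : Type*} [Finite ι]

theorem le_iSup_of_finite (f : ι → ℝ) (h : ι) : f h ≤ ⨆ h, f h :=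
  le_ciSup (Set.finite_range f).bddAbove h

theorem measurable_iSup_sum {X : Type*} [MeasurableSpace X] {n : ℕ} {F : ι → Fin n → X → ℝ}
    (hF : ∀ h i, Measurable (F h i)) : Measurable fun x => ⨆ h, ∑ i, F h i x := by
  fun_prop

variable [Nonempty ι]

theorem iSup_add_le (f g : ι → ℝ) : ⨆ h, (f h + g h) ≤ (⨆ h, f h) + ⨆ h, g h :=
  ciSup_le fun h => add_le_add (le_iSup_of_finite f h) (le_iSup_of_finite g h)

theorem abs_iSup_le {f : ι → ℝ} {M : ℝ} (hf : ∀ h, |f h| ≤ M) : |⨆ h, f h| ≤ M := by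
  obtain ⟨h, hh⟩ := exists_eq_ciSup_of_finite (f := f)
  exact hh ▸ hf h

/-- Take maximizers `h` and `k` of the two left suprema. Their sum is at most `u h + u k + |v h - v
k|`, and the sign of `v h - v k` decides which of the two points to test in which right supremum. -/
theorem iSup_contraction_pair (u v g : ι → ℝ) (hg : ∀ h k, |g h - g k| ≤ |v h - v k|) :
    (⨆ h, (u h + g h)) + ⨆ h, (u h - g h) ≤ (⨆ h, (u h + v h)) + ⨆ h, (u h - v h) := by
  obtain ⟨h, hh⟩ := exists_eq_ciSup_of_finite (f := fun h => u h + g h)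
  obtain ⟨k, hk⟩ := exists_eq_ciSup_of_finite (f := fun h => u h - g h)
  rw [← hh, ← hk]
  have h1 := (le_abs_self _).trans (hg h k)
  have a1 := le_iSup_of_finite (fun h => u h + v h) h
  have a2 := le_iSup_of_finite (fun h => u h - v h) k
  have b1 := le_iSup_of_finite (fun h => u h + v h) k
  have b2 := le_iSup_of_finite (fun h => u h - v h) h
  rcases abs_cases (v h - v k) with ⟨h2, -⟩ | ⟨h2, -⟩ <;> rw [h2] at h1 <;> linarith

theorem sum_bool_pi_succ {n : ℕ} (F : (Fin (n + 1) → Bool) → ℝ) :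
    ∑ s, F s = ∑ s : Fin n → Bool, (F (Fin.cons true s) + F (Fin.cons false s)) := by
  rw [← (Fin.consEquiv fun _ : Fin (n + 1) => Bool).sum_comp, Fintype.sum_prod_type,
    Fintype.sum_bool, Finset.sum_add_distrib]
  rfl

/-- The Ledoux–Talagrand contraction principle. -/
theorem sum_iSup_contraction {g : ℝ → ℝ} {L : ℝ}
    (hg : ∀ x y, |g x - g y| ≤ L * |x - y|) (hL : 0 ≤ L) {n : ℕ} (A : ι → ℝ)
    (t : Fin n → ι → ℝ) :
    ∑ s : Fin n → Bool, ⨆ h, (A h + ∑ i, sign (s i) * g (t i h)) ≤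
      ∑ s : Fin n → Bool, ⨆ h, (A h + ∑ i, sign (s i) * (L * t i h)) := by
  induction n generalizing A with
  | zero => simp
  | succ n ih =>
    simp only [sum_bool_pi_succ, Fin.sum_univ_succ, Fin.cons_zero, Fin.cons_succ, sign_true,
      sign_false, one_mul, neg_mul]
    -- Contract one coordinate by pairing its two signs; the resulting linear term is absorbed into
    -- `A`, which is why the induction generalizes over `A`.
    calc _ ≤ ∑ s : Fin n → Bool,
          ((⨆ h, ((A h + L * t 0 h) + ∑ i, sign (s i) * g (t i.succ h))) +
          ⨆ h, ((A h + -(L * t 0 h)) + ∑ i, sign (s i) * g (t i.succ h))) := by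
          refine Finset.sum_le_sum fun s _ => ?_
          have := iSup_contraction_pair (fun h => A h + ∑ i, sign (s i) * g (t i.succ h))
            (fun h => L * t 0 h) (fun h => g (t 0 h)) fun h k => by
              rw [← mul_sub, abs_mul, abs_of_nonneg hL]; exact hg _ _
          simp only [← add_assoc, add_right_comm (A _) _ (∑ i, _)]
          simpa only [sub_eq_add_neg] using this
      _ ≤ _ := by
          rw [Finset.sum_add_distrib, Finset.sum_add_distrib]
          have h1 := ih (fun h => A h + L * t 0 h) fun i => t i.succ
          have h2 := ih (fun h => A h + -(L * t 0 h)) fun i => t i.succ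
          simpa only [add_assoc] using add_le_add h1 h2

variable {W : Type*} [MeasurableSpace W] {μ : Measure W} [IsProbabilityMeasure μ]

theorem measurePreserving_pi_swap {n : ℕ} (s : Fin n → Bool) :
    MeasurePreserving (fun (p : Fin n → W × W) i => bif s i then p i else (p i).swap)
      (Measure.pi fun _ => μ.prod μ) (Measure.pi fun _ => μ.prod μ) := by
  refine measurePreserving_pi (fun _ => μ.prod μ) (fun _ => μ.prod μ)
    (f := fun i p => bif s i then p else p.swap) fun i => ?_
  cases s i
  · exact Measure.measurePreserving_swap
  · exact MeasurePreserving.id _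

theorem measurePreserving_pi_fst {n : ℕ} :
    MeasurePreserving (fun (p : Fin n → W × W) i => (p i).1)
      (Measure.pi fun _ => μ.prod μ) (Measure.pi fun _ => μ) :=
  measurePreserving_pi _ _ fun _ => measurePreserving_fst

theorem measurePreserving_pi_snd {n : ℕ} :
    MeasurePreserving (fun (p : Fin n → W × W) i => (p i).2)
      (Measure.pi fun _ => μ.prod μ) (Measure.pi fun _ => μ) :=
  measurePreserving_pi _ _ fun _ => measurePreserving_snd

theorem integral_comp_of_measurePreserving {X Y : Type*} [MeasurableSpace X] [MeasurableSpace Y]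
    {ν : Measure X} {κ : Measure Y} {T : X → Y} (hT : MeasurePreserving T ν κ) {F : Y → ℝ}
    (hF : Measurable F) : ∫ x, F (T x) ∂ν = ∫ y, F y ∂κ := by
  rw [← hT.map_eq, integral_map hT.measurable.aemeasurable hF.aestronglyMeasurable]

theorem integrable_iSup_sum {X : Type*} [MeasurableSpace X] {ν : Measure X} [IsFiniteMeasure ν]
    {n : ℕ} {F : ι → Fin n → X → ℝ} (hF : ∀ h i, Measurable (F h i)) {M : ℝ}
    (hM : ∀ h i x, |F h i x| ≤ M) : Integrable (fun x => ⨆ h, ∑ i, F h i x) ν := by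
  refine integrable_of_measurable_of_abs_le (measurable_iSup_sum hF) (M := n * M)
    fun x => abs_iSup_le fun h => ?_
  refine (Finset.abs_sum_le_sum_abs _ _).trans ?_
  exact (Finset.sum_le_card_nsmul _ _ M fun i _ => hM h i x).trans_eq (by simp)

/-- Exchanging the two copies at the coordinates where `s` is false preserves the law and puts the
signs in; subadditivity of the supremum then separates the copies. -/
theorem integral_iSup_swap_le {φ : ι → W → ℝ} (hφ : ∀ h, Measurable (φ h)) {M : ℝ}
    (hM : ∀ h w, |φ h w| ≤ M) {n : ℕ} (s : Fin n → Bool) :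
    ∫ p, ⨆ h, ∑ i, (φ h (p i).1 - φ h (p i).2) ∂(Measure.pi fun _ : Fin n => μ.prod μ) ≤
      (∫ w, ⨆ h, ∑ i, sign (s i) * φ h (w i) ∂(Measure.pi fun _ => μ)) +
        ∫ w, ⨆ h, ∑ i, sign (!(s i)) * φ h (w i) ∂(Measure.pi fun _ => μ) := by
  have hb : ∀ b h w, |sign b * φ h w| ≤ M := fun b h w => by
    rw [abs_mul, abs_sign, one_mul]; exact hM h w
  have hm : ∀ s : Fin n → Bool,
      Measurable fun w : Fin n → W => ⨆ h, ∑ i, sign (s i) * φ h (w i) :=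
    fun s => measurable_iSup_sum fun h i => by fun_prop
  rw [← integral_comp_of_measurePreserving measurePreserving_pi_fst (hm s),
    ← integral_comp_of_measurePreserving measurePreserving_pi_snd (hm fun i => !(s i)),
    ← integral_comp_of_measurePreserving (measurePreserving_pi_swap s)
      (measurable_iSup_sum fun h i => by fun_prop)]
  have hi1 : Integrable (fun p : Fin n → W × W => ⨆ h, ∑ i, sign (s i) * φ h (p i).1)
      (Measure.pi fun _ => μ.prod μ) :=
    integrable_iSup_sum (fun h i => by fun_prop) fun h i p => hb _ h _
  have hi2 : Integrable (fun p : Fin n → W × W => ⨆ h, ∑ i, sign (!(s i)) * φ h (p i).2)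
      (Measure.pi fun _ => μ.prod μ) :=
    integrable_iSup_sum (fun h i => by fun_prop) fun h i p => hb _ h _
  have hsum : ∀ p : Fin n → W × W, (⨆ h, ∑ i, (φ h (bif s i then p i else (p i).swap).1 -
      φ h (bif s i then p i else (p i).swap).2)) =
      ⨆ h, ∑ i, (sign (s i) * φ h (p i).1 + sign (!(s i)) * φ h (p i).2) := by
    intro p
    refine iSup_congr fun h => Finset.sum_congr rfl fun i _ => ?_
    cases s i <;> simp <;> ring_nf
  simp_rw [hsum]
  rw [← integral_add hi1 hi2]
  refine integral_mono ?_ (hi1.add hi2) fun p => ?_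
  · refine integrable_iSup_sum (M := M + M) (fun h i => by fun_prop) fun h i p => ?_
    exact (abs_add_le _ _).trans (add_le_add (hb _ h _) (hb _ h _))
  · simp only [Finset.sum_add_distrib]
    exact iSup_add_le _ _

/-- Ghost sample: each mean is an expectation over an independent copy, and a supremum of
expectations is at most the expectation of the supremum. -/
theorem integral_iSup_sub_integral_le {φ : ι → W → ℝ} (hφ : ∀ h, Measurable (φ h)) {M : ℝ}
    (hM : ∀ h w, |φ h w| ≤ M) (n : ℕ) :
    ∫ w, ⨆ h, ∑ i, (∫ v, φ h v ∂μ - φ h (w i)) ∂(Measure.pi fun _ : Fin n => μ) ≤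
      ∫ p, ⨆ h, ∑ i, (φ h (p i).1 - φ h (p i).2) ∂(Measure.pi fun _ : Fin n => μ.prod μ) := by
  have hdiff : ∀ h v w, |φ h v - φ h w| ≤ M + M := fun h v w =>
    (abs_sub _ _).trans (add_le_add (hM h v) (hM h w))
  have he := measurePreserving_arrowProdEquivProdArrow W W (Fin n) (fun _ => μ) (fun _ => μ)
  have hmeas : Measurable fun q : (Fin n → W) × (Fin n → W) =>
      ⨆ h, ∑ i, (φ h (q.1 i) - φ h (q.2 i)) :=
    measurable_iSup_sum fun h i => by fun_prop
  have hint : Integrable (fun q : (Fin n → W) × (Fin n → W) =>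
      ⨆ h, ∑ i, (φ h (q.1 i) - φ h (q.2 i)))
      ((Measure.pi fun _ => μ).prod (Measure.pi fun _ => μ)) :=
    integrable_iSup_sum (fun h i => by fun_prop) fun h i q => hdiff h _ _
  have h1 := integral_comp_of_measurePreserving he hmeas
  have hφi : ∀ h, Integrable (φ h) μ := fun h => integrable_of_measurable_of_abs_le (hφ h) (hM h)
  change ∫ p : Fin n → W × W, ⨆ h, ∑ i, (φ h (p i).1 - φ h (p i).2) ∂_ = _ at h1
  rw [h1, integral_prod_symm _ hint]
  refine integral_mono (integrable_iSup_sum (M := M + M) (fun h i => by fun_prop)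
    fun h i w => ?_) hint.integral_prod_right fun w => ciSup_le fun h => ?_
  · refine (abs_sub _ _).trans (add_le_add ?_ (hM h _))
    have := norm_integral_le_of_norm_le_const (μ := μ) (f := φ h) (C := M) (.of_forall (hM h))
    simpa using this
  · have hev : ∀ i : Fin n, Integrable (fun v : Fin n → W => φ h (v i) - φ h (w i))
        (Measure.pi fun _ => μ) := fun i =>
      integrable_of_measurable_of_abs_le (by fun_prop) fun v => hdiff h _ _
    have : ∑ i, (∫ v, φ h v ∂μ - φ h (w i)) =
        ∫ v : Fin n → W, ∑ i, (φ h (v i) - φ h (w i)) ∂(Measure.pi fun _ => μ) := by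
      rw [integral_finsetSum _ fun i _ => hev i]
      refine Finset.sum_congr rfl fun i _ => ?_
      rw [integral_sub (integrable_of_measurable_of_abs_le (by fun_prop) fun v => hM h _)
        (integrable_const _),
        integral_comp_of_measurePreserving (measurePreserving_eval (fun _ => μ) i) (hφ h)]
      simp
    rw [this]
    refine integral_mono (integrable_finsetSum _ fun i _ => hev i) ?_ fun v =>
      le_iSup_of_finite (fun h => ∑ i, (φ h (v i) - φ h (w i))) h
    exact integrable_iSup_sum (fun h i => by fun_prop) fun h i q => hdiff h _ _

/-- Symmetrization. -/
theorem integral_iSup_le_rademacher {φ : ι → W → ℝ} (hφ : ∀ h, Measurable (φ h)) {M : ℝ}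
    (hM : ∀ h w, |φ h w| ≤ M) (n : ℕ) :
    2 ^ n * ∫ w, ⨆ h, ∑ i, (∫ v, φ h v ∂μ - φ h (w i)) ∂(Measure.pi fun _ : Fin n => μ) ≤
      2 * ∑ s : Fin n → Bool, ∫ w, ⨆ h, ∑ i, sign (s i) * φ h (w i) ∂(Measure.pi fun _ => μ) := by
  have h := Finset.sum_le_sum fun (s : Fin n → Bool) (_ : s ∈ Finset.univ) =>
    (integral_iSup_sub_integral_le hφ hM n).trans (integral_iSup_swap_le (μ := μ) hφ hM s)
  rw [Finset.sum_add_distrib] at h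
  -- Flipping all signs permutes the sign patterns, so the two sums agree.
  have hnot := (Equiv.piCongrRight fun _ : Fin n => Equiv.boolNot).sum_comp
    fun s => ∫ w, ⨆ h, ∑ i, sign (s i) * φ h (w i) ∂(Measure.pi fun _ => μ)
  simp only [Equiv.piCongrRight_apply, Pi.map_apply, Equiv.boolNot_apply] at hnot
  rw [hnot] at h
  simpa [two_mul] using h

end Rademacher

/-! ### The lower tail bound for finite families -/

section SmallBall

variable {ι : Type*} [Finite ι] [Nonempty ι]
  {W : Type*} [MeasurableSpace W] {μ : Measure W} [IsProbabilityMeasure μ]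

theorem integrable_iSup_of_finite {X : Type*} [MeasurableSpace X] {ν : Measure X}
    {F : ι → X → ℝ} (hF : ∀ h, Measurable (F h)) (hi : ∀ h, Integrable (F h) ν) :
    Integrable (fun x => ⨆ h, F h x) ν := by
  have := Fintype.ofFinite ι
  refine (integrable_finsetSum Finset.univ fun h _ => (hi h).abs).mono'
    (Measurable.iSup hF).aestronglyMeasurable (.of_forall fun x => abs_iSup_le fun h => ?_)
  exact Finset.single_le_sum (f := fun h => |F h x|) (fun _ _ => abs_nonneg _) (Finset.mem_univ h)

theorem integrable_comp_eval {n : ℕ} {F : W → ℂ} (hF : Integrable F μ) (i : Fin n) :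
    Integrable (fun w : Fin n → W => F (w i)) (Measure.pi fun _ => μ) :=
  (measurePreserving_eval (fun _ : Fin n => μ) i).integrable_comp_of_integrable hF

/-- For fixed ζ only the real number `(ζ * f).re` enters, so scalar contraction applies sample by
sample. Homogeneity then extracts `‖ζ‖` and leaves a unit phase `u`. -/
theorem sum_integral_profile_le {n : ℕ} {f : ι → W → ℂ} (hf : ∀ h, Measurable (f h))
    (hfi : ∀ h, Integrable (f h) μ) {D : ℝ}
    (hD : ∀ u : ℂ, ‖u‖ = 1 → ∑ s : Fin n → Bool,
      ∫ w, ⨆ h, ∑ i, sign (s i) * (u * f h (w i)).re ∂(Measure.pi fun _ => μ) ≤ 2 ^ n * D)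
    (ζ : ℂ) :
    ∑ s : Fin n → Bool, ∫ w, ⨆ h, ∑ i, sign (s i) * profile (ζ * f h (w i)).re
      ∂(Measure.pi fun _ => μ) ≤ 2 * ‖ζ‖ * (2 ^ n * D) := by
  obtain ⟨u, hu, hz⟩ : ∃ u : ℂ, ‖u‖ = 1 ∧ ζ = ‖ζ‖ * u := by
    rcases eq_or_ne ζ 0 with rfl | h
    · exact ⟨1, by simp, by simp⟩
    · exact ⟨ζ / ‖ζ‖, by simp [h], by field_simp [norm_ne_zero_iff.2 h]⟩
  have hlin : ∀ s : Fin n → Bool, Integrable (fun w : Fin n → W =>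
      ⨆ h, ∑ i, sign (s i) * (2 * (ζ * f h (w i)).re)) (Measure.pi fun _ => μ) := fun s =>
    integrable_iSup_of_finite (fun h => by fun_prop) fun h => integrable_finsetSum _ fun i _ =>
      ((((integrable_comp_eval (hfi h) i).const_mul ζ).re).const_mul 2).const_mul _
  have hprof : ∀ s : Fin n → Bool, Integrable (fun w : Fin n → W =>
      ⨆ h, ∑ i, sign (s i) * profile (ζ * f h (w i)).re) (Measure.pi fun _ => μ) := fun s =>
    integrable_iSup_sum (M := 2) (fun h i => by fun_prop) fun h i w => by
      rw [abs_mul, abs_sign, one_mul, abs_of_nonneg (profile_nonneg _)]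
      exact profile_le_two _
  rw [← integral_finsetSum _ fun s _ => hprof s]
  calc _ ≤ ∫ w : Fin n → W, ∑ s : Fin n → Bool,
        ⨆ h, ∑ i, sign (s i) * (2 * (ζ * f h (w i)).re) ∂(Measure.pi fun _ => μ) := by
        refine integral_mono (integrable_finsetSum _ fun s _ => hprof s)
          (integrable_finsetSum _ fun s _ => hlin s) fun w => ?_
        have := sum_iSup_contraction abs_profile_sub_le zero_le_two (fun _ : ι => 0)
          fun (i : Fin n) h => (ζ * f h (w i)).re
        simpa using this
    _ = 2 * ‖ζ‖ * ∑ s : Fin n → Bool,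
        ∫ w, ⨆ h, ∑ i, sign (s i) * (u * f h (w i)).re ∂(Measure.pi fun _ => μ) := by
        rw [integral_finsetSum _ fun s _ => hlin s, Finset.mul_sum]
        refine Finset.sum_congr rfl fun s _ => ?_
        rw [← integral_const_mul]
        congr 1 with w
        rw [Real.mul_iSup_of_nonneg (by positivity)]
        refine iSup_congr fun h => ?_
        rw [Finset.mul_sum]
        refine Finset.sum_congr rfl fun i _ => ?_
        conv_lhs => rw [hz, mul_assoc, Complex.re_ofReal_mul]
        ring
    _ ≤ _ := mul_le_mul_of_nonneg_left (hD u hu) (by positivity)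

/-- The supremum of the ζ-average is at most the ζ-average of suprema. Fubini lets the previous
bound be used for each ζ, and the mean of `2 ‖ζ‖` is π/2. -/
theorem sum_integral_radial_le {n : ℕ} {f : ι → W → ℂ} (hf : ∀ h, Measurable (f h))
    (hfi : ∀ h, Integrable (f h) μ) {D : ℝ}
    (hD : ∀ u : ℂ, ‖u‖ = 1 → ∑ s : Fin n → Bool,
      ∫ w, ⨆ h, ∑ i, sign (s i) * (u * f h (w i)).re ∂(Measure.pi fun _ => μ) ≤ 2 ^ n * D) :
    ∑ s : Fin n → Bool, ∫ w, ⨆ h, ∑ i, sign (s i) * radial (f h (w i))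
      ∂(Measure.pi fun _ => μ) ≤ 2 ^ n * (Real.pi / 2 * D) := by
  have habs : ∀ b x, |sign b * profile x| ≤ 2 := fun b x => by
    rw [abs_mul, abs_sign, one_mul, abs_of_nonneg (profile_nonneg _)]
    exact profile_le_two _
  have hjoint : ∀ s : Fin n → Bool, Integrable (fun q : (Fin n → W) × ℂ =>
      ⨆ h, ∑ i, sign (s i) * profile (q.2 * f h (q.1 i)).re)
      ((Measure.pi fun _ => μ).prod sphereProj) := fun s =>
    integrable_iSup_sum (M := 2) (fun h i => by fun_prop) fun h i q => habs _ _
  have h1 : ∀ s : Fin n → Bool, ∫ w, ⨆ h, ∑ i, sign (s i) * radial (f h (w i))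
      ∂(Measure.pi fun _ => μ) ≤ ∫ ζ, ∫ w, ⨆ h, ∑ i, sign (s i) * profile (ζ * f h (w i)).re
        ∂(Measure.pi fun _ => μ) ∂sphereProj := by
    intro s
    rw [← integral_integral_swap (hjoint s)]
    have hr : ∀ h, Measurable fun w => radial (f h w) := fun h => measurable_radial.comp (hf h)
    refine integral_mono (integrable_iSup_sum (M := 4 / 3)
      (fun h i => ((hr h).comp (measurable_pi_apply i)).const_mul _)
      fun h i w => ?_) (hjoint s).integral_prod_left fun w => ciSup_le fun h => ?_
    · rw [abs_mul, abs_sign, one_mul, abs_of_nonneg (radial_nonneg _)]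
      exact radial_le _
    · have hi : ∀ i, Integrable (fun ζ => sign (s i) * profile (ζ * f h (w i)).re) sphereProj :=
        fun i => (integrable_profile _).const_mul _
      simp only [radial, ← integral_const_mul]
      rw [← integral_finsetSum _ fun i _ => hi i]
      refine integral_mono (integrable_finsetSum _ fun i _ => hi i) ?_ fun ζ =>
        le_iSup_of_finite (fun h => ∑ i, sign (s i) * profile (ζ * f h (w i)).re) h
      exact integrable_iSup_sum (M := 2) (fun h i => by fun_prop) fun h i q => habs _ _
  calc _ ≤ ∑ s : Fin n → Bool, ∫ ζ, ∫ w, ⨆ h, ∑ i, sign (s i) * profile (ζ * f h (w i)).re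
        ∂(Measure.pi fun _ => μ) ∂sphereProj := Finset.sum_le_sum fun s _ => h1 s
    _ = ∫ ζ, ∑ s : Fin n → Bool, ∫ w, ⨆ h, ∑ i, sign (s i) * profile (ζ * f h (w i)).re
        ∂(Measure.pi fun _ => μ) ∂sphereProj :=
        (integral_finsetSum _ fun s _ => (hjoint s).integral_prod_right).symm
    _ ≤ ∫ ζ, 2 * ‖ζ‖ * (2 ^ n * D) ∂sphereProj :=
        integral_mono (integrable_finsetSum _ fun s _ => (hjoint s).integral_prod_right)
          ((integrable_norm_sphereProj.const_mul _).mul_const _)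
          fun ζ => sum_integral_profile_le hf hfi hD ζ
    _ = _ := by
        rw [integral_mul_const, integral_const_mul, integral_norm_sphereProj]
        ring

/-- The small-ball lower tail bound for a finite family of functions. -/
theorem measureReal_exists_lt_le {n : ℕ} (hn : 0 < n) {f : ι → W → ℂ}
    (hf : ∀ h, Measurable (f h)) (hfi : ∀ h, Integrable (f h) μ) {p D : ℝ}
    (hp : ∀ h, p ≤ μ.real {w | 1 ≤ ‖f h w‖})
    (hD : ∀ u : ℂ, ‖u‖ = 1 → ∑ s : Fin n → Bool,
      ∫ w, ⨆ h, ∑ i, sign (s i) * (u * f h (w i)).re ∂(Measure.pi fun _ => μ) ≤ 2 ^ n * D)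
    {δ : ℝ} (hδ₀ : 0 < δ) (hδ₁ : δ < 1) :
    (Measure.pi fun _ => μ).real {w : Fin n → W | ∃ h, ∑ i, ‖f h (w i)‖ <
      n * p - Real.pi * D - n * √(Real.log (1 / δ) / n)} ≤ δ := by
  have hn' : (0 : ℝ) < n := by exact_mod_cast hn
  have hlog : 0 ≤ Real.log (1 / δ) := Real.log_nonneg (by rw [le_div_iff₀ hδ₀]; linarith)
  set r := √(Real.log (1 / δ) / n) with hr
  set φ : ι → W → ℝ := fun h w => radial (f h w) with hφ
  have hφm : ∀ h, Measurable (φ h) := fun h => measurable_radial.comp (hf h)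
  have hφM : ∀ h w, |φ h w| ≤ 4 / 3 := fun h w => by
    rw [abs_of_nonneg (radial_nonneg _)]; exact radial_le _
  have hφi : ∀ h, Integrable (φ h) μ := fun h => integrable_of_measurable_of_abs_le (hφm h) (hφM h)
  have hmean : ∀ h, p ≤ ∫ v, φ h v ∂μ := fun h => by
    refine (hp h).trans ?_
    have hs : MeasurableSet {w | 1 ≤ ‖f h w‖} := measurableSet_le measurable_const (hf h).norm
    rw [← integral_indicator_one hs]
    refine integral_mono ((integrable_const (1 : ℝ)).indicator hs) (hφi h) fun w => ?_
    by_cases hw : w ∈ {w | 1 ≤ ‖f h w‖}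
    · rw [Set.indicator_of_mem hw]; exact one_le_radial hw
    · rw [Set.indicator_of_notMem hw]; exact radial_nonneg _
  set F : (Fin n → W) → ℝ := fun w => ⨆ h, ∑ i, (∫ v, φ h v ∂μ - φ h (w i)) with hF
  have hEF : ∫ w, F w ∂(Measure.pi fun _ => μ) ≤ Real.pi * D := by
    have h1 := integral_iSup_le_rademacher (μ := μ) hφm hφM n
    have h2 := sum_integral_radial_le hf hfi hD
    have h3 := h1.trans (mul_le_mul_of_nonneg_left h2 zero_le_two)
    have h4 : (0 : ℝ) < 2 ^ n := by positivity
    refine le_of_mul_le_mul_left (h3.trans_eq ?_) h4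
    ring
  have hFm : Measurable F := measurable_iSup_sum fun h i => by fun_prop
  have hFM : ∀ w, |F w| ≤ n * (4 / 3 + 4 / 3) := fun w => abs_iSup_le fun h => by
    refine (Finset.abs_sum_le_sum_abs _ _).trans ?_
    refine (Finset.sum_le_card_nsmul _ _ (4 / 3 + 4 / 3) fun i _ => ?_).trans_eq
      (by rw [Finset.card_univ, Fintype.card_fin, nsmul_eq_mul])
    refine (abs_sub _ _).trans (add_le_add ?_ (hφM h _))
    have := norm_integral_le_of_norm_le_const (μ := μ) (f := φ h) (C := 4 / 3) (.of_forall (hφM h))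
    simpa using this
  -- Since `radial` takes values in `[0, 4/3]`, replacing one sample changes every sum by at most
  -- 4/3.
  have hFc : ∀ x i v, F x - F (Function.update x i v) ≤ 4 / 3 := by
    intro x i v
    rw [sub_le_iff_le_add']
    refine ciSup_le fun h => ?_
    have h1 := le_iSup_of_finite
      (fun h => ∑ j, (∫ v, φ h v ∂μ - φ h (Function.update x i v j))) h
    have h2 : ∑ j, (∫ v, φ h v ∂μ - φ h (x j)) =
        ∑ j, (∫ v, φ h v ∂μ - φ h (Function.update x i v j)) + (φ h v - φ h (x i)) := by
      have hoff : ∑ j ∈ Finset.univ.erase i, (∫ v, φ h v ∂μ - φ h (Function.update x i v j)) =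
          ∑ j ∈ Finset.univ.erase i, (∫ v, φ h v ∂μ - φ h (x j)) :=
        Finset.sum_congr rfl fun j hj => by
          rw [Function.update_of_ne (Finset.ne_of_mem_erase hj)]
      rw [← Finset.add_sum_erase _ _ (Finset.mem_univ i),
        ← Finset.add_sum_erase _ (fun j => ∫ v, φ h v ∂μ - φ h (Function.update x i v j))
          (Finset.mem_univ i), Function.update_self, hoff]
      ring
    have h3 : φ h v ≤ 4 / 3 := radial_le _
    have h4 : 0 ≤ φ h (x i) := radial_nonneg _
    rw [h2]
    linarith
  have hmc := measureReal_ge_le_of_bounded_differences (μ := μ) hFm hFM hFc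
    (s := n * r) (by positivity)
  -- If the sum for some `h` is small, then `F w ≥ n p - ∑ ‖f h‖ > π D + n r ≥ E F + n r`.
  calc _ ≤ (Measure.pi fun _ => μ).real
        {w | n * r ≤ F w - ∫ y, F y ∂(Measure.pi fun _ => μ)} := by
        refine measureReal_mono fun w hw => ?_
        obtain ⟨h, hh⟩ := hw
        have h1 := le_iSup_of_finite (fun h => ∑ i, (∫ v, φ h v ∂μ - φ h (w i))) h
        have h2 : ∑ i, φ h (w i) ≤ ∑ i, ‖f h (w i)‖ :=
          Finset.sum_le_sum fun i _ => radial_le_norm _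
        have h3 := mul_le_mul_of_nonneg_left (hmean h) hn'.le
        simp only [Finset.sum_sub_distrib, Finset.sum_const, Finset.card_univ, Fintype.card_fin,
          nsmul_eq_mul] at h1
        change n * r ≤ F w - _
        have h4 : F w = ⨆ h, ((n : ℝ) * ∫ v, φ h v ∂μ - ∑ i, φ h (w i)) := by
          simp [hF, Finset.sum_sub_distrib]
        linarith
    _ ≤ _ := hmc
    -- The exponent carries 2 / (4/3)² = 9/8, and the excess over 1 is discarded.
    _ ≤ Real.exp (-Real.log (1 / δ)) := by
        rw [Real.exp_le_exp, mul_pow, Real.sq_sqrt (by positivity)]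
        have : -(2 * ((n : ℝ) ^ 2 * (Real.log (1 / δ) / n))) / (n * (4 / 3) ^ 2) =
          -(9 / 8) * Real.log (1 / δ) := by generalize Real.log (1 / δ) = l; field_simp; ring
        linarith
    _ = δ := by rw [Real.exp_neg, Real.exp_log (by positivity)]; simp

end SmallBall

/-! ### From Rademacher variables to averages over sign patterns -/

section RademacherLaw

variable {Ω : Type*} [MeasurableSpace Ω] {P : Measure Ω} [IsProbabilityMeasure P]

theorem measurable_sign : Measurable sign := .of_discrete

theorem IsRademacher.ae_eq_or_eq {X : Ω → ℝ} (hX : Measurable X) (h : IsRademacher P X) :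
    ∀ᵐ ω ∂P, X ω = 1 ∨ X ω = -1 := by
  have h1 : MeasurableSet {ω | X ω = 1} := hX (measurableSet_singleton 1)
  have h2 : MeasurableSet {ω | X ω = -1} := hX (measurableSet_singleton (-1))
  refine (mem_ae_iff_prob_eq_one (h1.union h2)).2 ?_
  rw [measure_union _ h2, h.1, h.2, ENNReal.add_halves]
  rw [Set.disjoint_left]
  intro ω (hω : X ω = 1) (hω' : X ω = -1)
  linarith

theorem measurable_decide_eq_one {X : Ω → ℝ} (hX : Measurable X) :
    Measurable fun ω => decide (X ω = 1) := by
  refine measurable_to_bool ?_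
  convert hX (measurableSet_singleton 1) using 1
  ext ω; simp

theorem IsRademacher.map_decide_singleton {X : Ω → ℝ} (hX : Measurable X) (h : IsRademacher P X)
    (b : Bool) : P.map (fun ω => decide (X ω = 1)) {b} = 1 / 2 := by
  have h1 : MeasurableSet {ω | X ω = 1} := hX (measurableSet_singleton 1)
  rw [Measure.map_apply (measurable_decide_eq_one hX) (measurableSet_singleton b)]
  cases b
  · have : (fun ω => decide (X ω = 1)) ⁻¹' {false} = {ω | X ω = 1}ᶜ := by ext ω; simp
    rw [this, prob_compl_eq_one_sub h1, h.1]
    simp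
  · have : (fun ω => decide (X ω = 1)) ⁻¹' {true} = {ω | X ω = 1} := by ext ω; simp
    rw [this, h.1]

theorem sign_decide_eq {x : ℝ} (h : x = 1 ∨ x = -1) : sign (decide (x = 1)) = x := by
  rcases h with rfl | rfl
  · simp
  · have : ¬ (-1 : ℝ) = 1 := by norm_num
    simp [this]

theorem integral_pi_bool {n : ℕ} {ν : Fin n → Measure Bool} [∀ i, IsProbabilityMeasure (ν i)]
    (hν : ∀ i b, ν i {b} = 1 / 2) (F : (Fin n → Bool) → ℝ) :
    ∫ s, F s ∂(Measure.pi ν) = (2 ^ n)⁻¹ * ∑ s, F s := by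
  rw [integral_fintype (.of_finite), Finset.mul_sum]
  refine Finset.sum_congr rfl fun s _ => ?_
  simp [Measure.real, Measure.pi_singleton, hν]

variable {ι : Type*} [Finite ι] [Nonempty ι] {W : Type*} [MeasurableSpace W]

/-- Almost surely each `ε i` is the sign of a fair Boolean, so by independence the joint law of
signs and samples is a product and the sign integral is a finite average. -/
theorem integral_iSup_rademacher {n : ℕ} {ε : Fin n → Ω → ℝ} {w : Fin n → Ω → W} {μ : Measure W}
    [IsProbabilityMeasure μ]
    (hε : ∀ i, Measurable (ε i)) (hw : ∀ i, Measurable (w i)) (hrad : ∀ i, IsRademacher P (ε i))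
    (hεi : iIndepFun ε P) (hwi : iIndepFun w P) (hlaw : ∀ i, P.map (w i) = μ)
    (hεw : IndepFun (fun ω i => ε i ω) (fun ω i => w i ω) P)
    {t : ι → W → ℝ} (ht : ∀ h, Measurable (t h)) (hti : ∀ h, Integrable (t h) μ) :
    ∑ s : Fin n → Bool, ∫ v, ⨆ h, ∑ i, sign (s i) * t h (v i) ∂(Measure.pi fun _ => μ) =
      2 ^ n * ∫ ω, ⨆ h, ∑ i, ε i ω * t h (w i ω) ∂P := by
  set σ : Fin n → Ω → Bool := fun i ω => decide (ε i ω = 1) with hσ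
  have hσm : ∀ i, Measurable (σ i) := fun i => measurable_decide_eq_one (hε i)
  have hdec : Measurable fun x : ℝ => decide (x = 1) := measurable_decide_eq_one measurable_id
  have hσlaw : P.map (fun ω i => σ i ω) = Measure.pi fun i => P.map (σ i) :=
    (iIndepFun_iff_map_fun_eq_pi_map fun i => (hσm i).aemeasurable).1
      (hεi.comp (fun _ x => decide (x = 1)) fun _ => hdec)
  have hwlaw : P.map (fun ω i => w i ω) = Measure.pi fun _ => μ := by
    rw [(iIndepFun_iff_map_fun_eq_pi_map fun i => (hw i).aemeasurable).1 hwi]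
    simp_rw [hlaw]
  have hind : IndepFun (fun ω i => σ i ω) (fun ω i => w i ω) P :=
    hεw.comp (φ := fun (x : Fin n → ℝ) i => decide (x i = 1)) (ψ := id)
      (measurable_pi_lambda _ fun i => hdec.comp (measurable_pi_apply i)) measurable_id
  have hσv : Measurable fun ω i => σ i ω := measurable_pi_lambda _ hσm
  have hwv : Measurable fun ω i => w i ω := measurable_pi_lambda _ hw
  have hjoint := (indepFun_iff_map_prod_eq_prod_map_map hσv.aemeasurable hwv.aemeasurable).1 hind
  have hprob : ∀ i, IsProbabilityMeasure (P.map (σ i)) := fun i =>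
    Measure.isProbabilityMeasure_map (hσm i).aemeasurable
  rw [hσlaw, hwlaw] at hjoint
  set G : (Fin n → Bool) × (Fin n → W) → ℝ := fun q => ⨆ h, ∑ i, sign (q.1 i) * t h (q.2 i)
    with hG
  have hGm : Measurable G := by
    have := measurable_sign
    fun_prop
  have hGs : ∀ s, Integrable (fun v => G (s, v)) (Measure.pi fun _ => μ) := fun s =>
    integrable_iSup_of_finite (fun h => by fun_prop) fun h => integrable_finsetSum _ fun i _ =>
      (show Integrable (fun v : Fin n → W => t h (v i)) _ from (measurePreserving_eval
        (fun _ : Fin n => μ) i).integrable_comp_of_integrable (hti h)).const_mul (sign (s i))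
  have hGi : Integrable G ((Measure.pi fun i => P.map (σ i)).prod (Measure.pi fun _ => μ)) :=
    (integrable_prod_iff hGm.aestronglyMeasurable).2 ⟨.of_forall hGs, .of_finite⟩
  have h1 : ∫ ω, ⨆ h, ∑ i, ε i ω * t h (w i ω) ∂P =
      ∫ ω, G (fun i => σ i ω, fun i => w i ω) ∂P := by
    refine integral_congr_ae ?_
    filter_upwards [ae_all_iff.2 fun i => (hrad i).ae_eq_or_eq (hε i)] with ω hω
    refine iSup_congr fun h => Finset.sum_congr rfl fun i _ => ?_
    rw [hσ, sign_decide_eq (hω i)]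
  rw [h1, ← integral_map (hσv.prodMk hwv).aemeasurable hGm.aestronglyMeasurable, hjoint,
    integral_prod _ hGi, integral_pi_bool fun i => (hrad i).map_decide_singleton (hε i),
    mul_inv_cancel_left₀ (by positivity)]

end RademacherLaw

/-! ### Sesquilinear measurements and their envelope -/

section Matrices

variable {d₁ d₂ : ℕ}

/-- The sesquilinear measurement `a* H b`. -/
noncomputable def measurement (H : Matrix (Fin d₁) (Fin d₂) ℂ) (w : (Fin d₁ → ℂ) × (Fin d₂ → ℂ)) :
    ℂ :=
  star w.1 ⬝ᵥ (H *ᵥ w.2)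

theorem measurement_eq_sum (H : Matrix (Fin d₁) (Fin d₂) ℂ) (w : (Fin d₁ → ℂ) × (Fin d₂ → ℂ)) :
    measurement H w = ∑ j, ∑ k, star (w.1 j) * (H j k * w.2 k) := by
  simp [measurement, dotProduct, Matrix.mulVec, Finset.mul_sum]

theorem measurement_smul (c : ℂ) (H : Matrix (Fin d₁) (Fin d₂) ℂ)
    (w : (Fin d₁ → ℂ) × (Fin d₂ → ℂ)) : measurement (c • H) w = c * measurement H w := by
  simp [measurement, Matrix.smul_mulVec, dotProduct_smul]

theorem realInner_vecMulVec (H : Matrix (Fin d₁) (Fin d₂) ℂ) (a : Fin d₁ → ℂ) (b : Fin d₂ → ℂ) :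
    realInner (Matrix.vecMulVec a (star b)) H = (measurement H (a, b)).re := by
  unfold realInner
  congr 1
  simp only [measurement_eq_sum, Matrix.trace, Matrix.diag, Matrix.mul_apply,
    Matrix.conjTranspose_apply, Matrix.vecMulVec_apply, Pi.star_apply, star_mul', star_star]
  rw [Finset.sum_comm]
  refine Finset.sum_congr rfl fun j _ => Finset.sum_congr rfl fun k _ => ?_
  ring

theorem norm_apply_le_frobenius (H : Matrix (Fin d₁) (Fin d₂) ℂ) (j : Fin d₁) (k : Fin d₂) :
    ‖H j k‖ ≤ ‖H‖ := by
  rw [Matrix.frobenius_norm_def, ← Real.sqrt_eq_rpow]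
  refine Real.le_sqrt_of_sq_le ?_
  have h1 := Finset.single_le_sum (f := fun k => ‖H j k‖ ^ (2 : ℝ))
    (fun _ _ => by positivity) (Finset.mem_univ k)
  have h2 := Finset.single_le_sum (f := fun j => ∑ k, ‖H j k‖ ^ (2 : ℝ))
    (fun _ _ => by positivity) (Finset.mem_univ j)
  rw [← Real.rpow_two]
  exact h1.trans h2

theorem frobenius_norm_smul (c : ℂ) (hc : ‖c‖ = 1) (H : Matrix (Fin d₁) (Fin d₂) ℂ) :
    ‖c • H‖ = ‖H‖ := by
  simp [Matrix.frobenius_norm_def, hc]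

/-- An envelope for the normalized measurements. -/
noncomputable def envelope (w : (Fin d₁ → ℂ) × (Fin d₂ → ℂ)) : ℝ := ∑ j, ∑ k, ‖w.1 j‖ * ‖w.2 k‖

theorem norm_measurement_le (H : Matrix (Fin d₁) (Fin d₂) ℂ) (w : (Fin d₁ → ℂ) × (Fin d₂ → ℂ)) :
    ‖measurement H w‖ ≤ ‖H‖ * envelope w := by
  rw [measurement_eq_sum, envelope, Finset.mul_sum]
  refine (norm_sum_le _ _).trans (Finset.sum_le_sum fun j _ => ?_)
  rw [Finset.mul_sum]
  refine (norm_sum_le _ _).trans (Finset.sum_le_sum fun k _ => ?_)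
  rw [norm_mul, norm_mul, norm_star]
  nlinarith [mul_le_mul_of_nonneg_right (norm_apply_le_frobenius H j k)
    (mul_nonneg (norm_nonneg (w.1 j)) (norm_nonneg (w.2 k)))]

@[fun_prop]
theorem measurable_measurement (H : Matrix (Fin d₁) (Fin d₂) ℂ) : Measurable (measurement H) := by
  have : measurement H = fun w => ∑ j, ∑ k, star (w.1 j) * (H j k * w.2 k) :=
    funext (measurement_eq_sum H)
  rw [this]
  exact (Continuous.measurable (by fun_prop))

theorem continuous_measurement (w : (Fin d₁ → ℂ) × (Fin d₂ → ℂ)) :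
    Continuous fun H : Matrix (Fin d₁) (Fin d₂) ℂ => measurement H w := by
  unfold measurement
  fun_prop

/-- Products of square-integrable entries are integrable, whatever the dependence between the two
factors. This dominates all normalized measurements at once. -/
theorem integrable_envelope {Ω : Type*} [MeasurableSpace Ω] {P : Measure Ω}
    {a : Ω → Fin d₁ → ℂ} {b : Ω → Fin d₂ → ℂ} (ha : ∀ j, MemLp (fun ω => a ω j) 2 P)
    (hb : ∀ k, MemLp (fun ω => b ω k) 2 P) : Integrable (fun ω => envelope (a ω, b ω)) P :=
  integrable_finsetSum _ fun j _ => integrable_finsetSum _ fun k _ =>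
    (ha j).norm.integrable_mul (hb k).norm

theorem exists_countable_dense_diff_zero (T : Set (Matrix (Fin d₁) (Fin d₂) ℂ)) :
    ∃ S : Set ↥(T \ {0}), S.Countable ∧ Dense S := by
  have : SecondCountableTopology (Matrix (Fin d₁) (Fin d₂) ℂ) :=
    inferInstanceAs (SecondCountableTopology (Fin d₁ → Fin d₂ → ℂ))
  exact TopologicalSpace.exists_countable_dense _

theorem norm_pos_of_mem_diff_zero {T : Set (Matrix (Fin d₁) (Fin d₂) ℂ)} (H : ↥(T \ {0})) :
    0 < ‖H.1‖ := norm_pos_iff.2 H.2.2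

theorem continuous_norm_measurement_div (T : Set (Matrix (Fin d₁) (Fin d₂) ℂ))
    (w : (Fin d₁ → ℂ) × (Fin d₂ → ℂ)) :
    Continuous fun H : ↥(T \ {0}) => ‖measurement H.1 w‖ / ‖H.1‖ :=
  ((continuous_measurement w).comp continuous_subtype_val).norm.div₀
    continuous_subtype_val.norm fun H => (norm_pos_of_mem_diff_zero H).ne'

theorem continuous_re_measurement_div (T : Set (Matrix (Fin d₁) (Fin d₂) ℂ))
    (w : (Fin d₁ → ℂ) × (Fin d₂ → ℂ)) :
    Continuous fun H : ↥(T \ {0}) => (measurement H.1 w).re / ‖H.1‖ :=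
  (Complex.continuous_re.comp ((continuous_measurement w).comp continuous_subtype_val)).div₀
    continuous_subtype_val.norm fun H => (norm_pos_of_mem_diff_zero H).ne'

end Matrices
-- Measurability, integrability and phase invariance of the complexity
section Complexity

variable {d₁ d₂ n : ℕ} {T : Set (Matrix (Fin d₁) (Fin d₂) ℂ)}

theorem measurable_realInner_vecMulVec (H : Matrix (Fin d₁) (Fin d₂) ℂ) :
    Measurable fun w : (Fin d₁ → ℂ) × (Fin d₂ → ℂ) =>
      realInner (Matrix.vecMulVec w.1 (star w.2)) H := by
  simp_rw [realInner_vecMulVec]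
  fun_prop

theorem abs_realInner_div_le (H : ↥(T \ {0})) (a : Fin d₁ → ℂ) (b : Fin d₂ → ℂ) :
    |realInner (Matrix.vecMulVec a (star b)) H.1 / ‖H.1‖| ≤ envelope (a, b) := by
  rw [realInner_vecMulVec, abs_div, abs_of_nonneg (norm_nonneg _),
    div_le_iff₀ (norm_pos_of_mem_diff_zero H), mul_comm]
  exact (Complex.abs_re_le_norm _).trans (norm_measurement_le _ _)

theorem abs_rademacher_sum_le (x : Fin n → ℝ) (a : Fin n → Fin d₁ → ℂ) (b : Fin n → Fin d₂ → ℂ)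
    (H : ↥(T \ {0})) :
    |(1 / √(n : ℝ)) * ∑ i, x i * realInner (Matrix.vecMulVec (a i) (star (b i))) H.1 / ‖H.1‖| ≤
      (1 / √(n : ℝ)) * ∑ i, |x i| * envelope (a i, b i) := by
  rw [abs_mul, abs_of_nonneg (by positivity)]
  refine mul_le_mul_of_nonneg_left ((Finset.abs_sum_le_sum_abs _ _).trans
    (Finset.sum_le_sum fun i _ => ?_)) (by positivity)
  rw [mul_div_assoc, abs_mul]
  exact mul_le_mul_of_nonneg_left (abs_realInner_div_le H _ _) (abs_nonneg _)

theorem bddAbove_rademacher_sum (x : Fin n → ℝ) (a : Fin n → Fin d₁ → ℂ)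
    (b : Fin n → Fin d₂ → ℂ) :
    BddAbove (Set.range fun H : ↥(T \ {0}) => (1 / √(n : ℝ)) *
      ∑ i, x i * realInner (Matrix.vecMulVec (a i) (star (b i))) H.1 / ‖H.1‖) :=
  ⟨_, by rintro _ ⟨H, rfl⟩; exact (abs_le.1 (abs_rademacher_sum_le x a b H)).2⟩

theorem integrable_measurement {Ω : Type*} [MeasurableSpace Ω]
    {P : Measure Ω} (H : Matrix (Fin d₁) (Fin d₂) ℂ) {a : Ω → Fin d₁ → ℂ}
    {b : Ω → Fin d₂ → ℂ} (ha : Measurable a) (hb : Measurable b)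
    (henv : Integrable (fun ω => envelope (a ω, b ω)) P) :
    Integrable (fun ω => measurement H (a ω, b ω)) P :=
  (henv.const_mul ‖H‖).mono' ((measurable_measurement H).comp (ha.prodMk hb)).aestronglyMeasurable
    (.of_forall fun _ => norm_measurement_le H _)

variable {Ω : Type*} [MeasurableSpace Ω] {P : Measure Ω} [IsProbabilityMeasure P]
  {a : Fin n → Ω → Fin d₁ → ℂ} {b : Fin n → Ω → Fin d₂ → ℂ} {ε : Fin n → Ω → ℝ}

/-- Continuity in `H` reduces the possibly uncountable supremum to a countable dense set. -/
theorem measurable_iSup_rademacher_sum (ha : ∀ i, Measurable (a i)) (hb : ∀ i, Measurable (b i))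
    (hε : ∀ i, Measurable (ε i)) :
    Measurable fun ω => ⨆ H : ↥(T \ {0}), (1 / √(n : ℝ)) *
      ∑ i, ε i ω * realInner (Matrix.vecMulVec (a i ω) (star (b i ω))) H.1 / ‖H.1‖ := by
  obtain ⟨S, hSc, hSd⟩ := exists_countable_dense_diff_zero T
  have := hSc.to_subtype
  have hcont : ∀ ω, Continuous fun H : ↥(T \ {0}) => (1 / √(n : ℝ)) *
      ∑ i, ε i ω * realInner (Matrix.vecMulVec (a i ω) (star (b i ω))) H.1 / ‖H.1‖ := fun ω => by
    simp_rw [realInner_vecMulVec, mul_div_assoc]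
    exact continuous_const.mul (continuous_finsetSum _ fun i _ =>
      continuous_const.mul (continuous_re_measurement_div T _))
  simp_rw [← fun ω => hSd.ciSup' (hcont ω)]
  refine Measurable.iSup fun H => measurable_const.mul (Finset.measurable_sum _ fun i _ => ?_)
  exact ((hε i).mul ((measurable_realInner_vecMulVec _).comp
    ((ha i).prodMk (hb i)))).div_const _

/-- Without integrability the Bochner integral defining the complexity would default to 0 and could
not dominate the finite suprema. -/
theorem integrable_iSup_rademacher_sum (hne : Nonempty ↥(T \ {0}))
    (ha : ∀ i, Measurable (a i)) (hb : ∀ i, Measurable (b i))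
    (hε : ∀ i, Measurable (ε i)) (hrad : ∀ i, IsRademacher P (ε i))
    (henv : ∀ i, Integrable (fun ω => envelope (a i ω, b i ω)) P) :
    Integrable (fun ω => ⨆ H : ↥(T \ {0}), (1 / √(n : ℝ)) *
      ∑ i, ε i ω * realInner (Matrix.vecMulVec (a i ω) (star (b i ω))) H.1 / ‖H.1‖) P := by
  refine ((integrable_finsetSum Finset.univ fun i _ => henv i).const_mul (1 / √(n : ℝ))).mono'
    (measurable_iSup_rademacher_sum ha hb hε).aestronglyMeasurable ?_
  filter_upwards [ae_all_iff.2 fun i => (hrad i).ae_eq_or_eq (hε i)] with ω hω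
  have habs : ∀ i, |ε i ω| = 1 := fun i => by rcases hω i with h | h <;> simp [h]
  have hbd : ∀ H : ↥(T \ {0}), _ := fun H =>
    abs_rademacher_sum_le (fun i => ε i ω) (fun i => a i ω) (fun i => b i ω) H
  simp only [habs, one_mul] at hbd
  rw [Real.norm_eq_abs, abs_le]
  have H := Classical.arbitrary ↥(T \ {0})
  exact ⟨(abs_le.1 (hbd H)).1.trans (le_ciSup (bddAbove_rademacher_sum (T := T)
    (fun i => ε i ω) (fun i => a i ω) (fun i => b i ω)) H),
    ciSup_le fun H => (abs_le.1 (hbd H)).2⟩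

variable {ι : Type*} [Finite ι] [Nonempty ι]

/-- The phase `u` moves into the matrix: `u • K h` stays in `T \ {0}` with the same norm, so it
competes in the full supremum. The factor `√n / τ` accounts for the two normalizations. -/
theorem integral_iSup_measurement_le (hn : 0 < n)
    (hT : ∀ c : ℂ, ‖c‖ = 1 → ∀ H ∈ T, c • H ∈ T)
    (ha : ∀ i, Measurable (a i)) (hb : ∀ i, Measurable (b i))
    (hε : ∀ i, Measurable (ε i)) (hrad : ∀ i, IsRademacher P (ε i))
    (henv : ∀ i, Integrable (fun ω => envelope (a i ω, b i ω)) P)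
    (K : ι → ↥(T \ {0})) {τ : ℝ} (hτ : 0 < τ) {u : ℂ} (hu : ‖u‖ = 1) :
    ∫ ω, ⨆ h, ∑ i, ε i ω * (u * (measurement (K h).1 (a i ω, b i ω) / (τ * ‖(K h).1‖ : ℝ))).re ∂P ≤
      √n / τ * rademacherComplexity P a b ε T := by
  have hne : Nonempty ↥(T \ {0}) := ⟨K (Classical.arbitrary ι)⟩
  have hn' : (0 : ℝ) < √n := Real.sqrt_pos.2 (by exact_mod_cast hn)
  rw [rademacherComplexity, ← integral_const_mul]
  have hle : ∀ ω, (⨆ h, ∑ i,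
      ε i ω * (u * (measurement (K h).1 (a i ω, b i ω) / (τ * ‖(K h).1‖ : ℝ))).re) ≤
      √n / τ * ⨆ H : ↥(T \ {0}), (1 / √(n : ℝ)) *
        ∑ i, ε i ω * realInner (Matrix.vecMulVec (a i ω) (star (b i ω))) H.1 / ‖H.1‖ := by
    intro ω
    refine ciSup_le fun h => ?_
    have hmem : u • (K h).1 ∈ T \ {0} := by
      refine ⟨hT u hu _ (K h).2.1, fun h0 => (K h).2.2 ?_⟩
      have hu0 : u ≠ 0 := fun hu0 => by simp [hu0] at hu
      exact (smul_eq_zero.1 h0).resolve_left hu0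
    have h1 := le_ciSup (bddAbove_rademacher_sum (T := T)
      (fun i => ε i ω) (fun i => a i ω) (fun i => b i ω)) ⟨u • (K h).1, hmem⟩
    refine le_trans (le_of_eq ?_) (mul_le_mul_of_nonneg_left h1 (by positivity))
    simp only [realInner_vecMulVec, measurement_smul, frobenius_norm_smul u hu]
    rw [← mul_assoc, Finset.mul_sum]
    refine Finset.sum_congr rfl fun i _ => ?_
    have hK := norm_pos_of_mem_diff_zero (K h)
    rw [← mul_div_assoc, Complex.div_ofReal_re]
    field_simp
  refine integral_mono (integrable_iSup_of_finite (fun h => ?_) fun h =>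
    integrable_finsetSum _ fun i _ => ?_)
    ((integrable_iSup_rademacher_sum hne ha hb hε hrad henv).const_mul _) hle
  · have := measurable_measurement (K h).1
    fun_prop
  · refine Integrable.bdd_mul (c := 1) ((((integrable_measurement (K h).1 (ha i) (hb i)
      (henv i)).div_const _).const_mul u).re) (hε i).aestronglyMeasurable ?_
    filter_upwards [(hrad i).ae_eq_or_eq (hε i)] with _ hω
    rcases hω with hω | hω <;> simp [hω]

end Complexity
theorem measurableSet_smallBall {d₁ d₂ : ℕ} (H : Matrix (Fin d₁) (Fin d₂) ℂ) (c : ℝ) :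
    MeasurableSet {w | c ≤ ‖measurement H w‖} :=
  measurableSet_le measurable_const (measurable_measurement H).norm

theorem measureReal_iUnion_le_of_monotone {Ω : Type*} [MeasurableSpace Ω] {P : Measure Ω}
    [IsFiniteMeasure P] {A : ℕ → Set Ω} (hA : Monotone A) {δ : ℝ} (h : ∀ N, P.real (A N) ≤ δ) :
    P.real (⋃ N, A N) ≤ δ := by
  have h0 : 0 ≤ δ := measureReal_nonneg.trans (h 0)
  refine ENNReal.toReal_le_of_le_ofReal h0 ?_
  rw [hA.measure_iUnion]
  exact iSup_le fun N => (ENNReal.le_ofReal_iff_toReal_le (measure_ne_top _ _) h0).2 (h N)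

theorem smallBallProb_le {Ω : Type*} [MeasurableSpace Ω] {P : Measure Ω} {d₁ d₂ : ℕ}
    {T : Set (Matrix (Fin d₁) (Fin d₂) ℂ)} {a₀ : Ω → Fin d₁ → ℂ} {b₀ : Ω → Fin d₂ → ℂ} (τ : ℝ) (H : ↥(T \ {0})) :
    smallBallProb P a₀ b₀ τ T ≤ P.real {ω | τ * ‖H.1‖ ≤ ‖star (a₀ ω) ⬝ᵥ (H.1 *ᵥ b₀ ω)‖} :=
  ciInf_le (f := fun H : ↥(T \ {0}) =>
    P.real {ω | τ * ‖H.1‖ ≤ ‖star (a₀ ω) ⬝ᵥ (H.1 *ᵥ b₀ ω)‖})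
    ⟨0, by rintro _ ⟨H, rfl⟩; exact measureReal_nonneg⟩ H

/-! ### The bound for finitely many matrices -/

section FiniteFamily

variable {Ω : Type*} [MeasurableSpace Ω] {P : Measure Ω} [IsProbabilityMeasure P]
  {d₁ d₂ n : ℕ} {T : Set (Matrix (Fin d₁) (Fin d₂) ℂ)}
  {a₀ : Ω → Fin d₁ → ℂ} {b₀ : Ω → Fin d₂ → ℂ}
  {a : Fin n → Ω → Fin d₁ → ℂ} {b : Fin n → Ω → Fin d₂ → ℂ} {ε : Fin n → Ω → ℝ}

/-- Dividing measurements by `τ ‖H‖` puts the threshold at 1 and makes `D` equal to `√n / τ` times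
the complexity; multiplying the resulting inequality by `τ / n` restores the stated scaling. -/
theorem measureReal_exists_measurement_lt_le (hn : 0 < n)
    (hT : ∀ c : ℂ, ‖c‖ = 1 → ∀ H ∈ T, c • H ∈ T)
    (ha₀_meas : Measurable a₀) (hb₀_meas : Measurable b₀)
    (ha_meas : ∀ i, Measurable (a i)) (hb_meas : ∀ i, Measurable (b i))
    (hε_meas : ∀ i, Measurable (ε i))
    (ha_iso : IsIsotropic P a₀) (hb_iso : IsIsotropic P b₀)
    (h_indep : iIndepFun (fun i ω => (a i ω, b i ω)) P)
    (h_ident : ∀ i, IdentDistrib (fun ω => (a i ω, b i ω)) (fun ω => (a₀ ω, b₀ ω)) P P)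
    (hε_rad : ∀ i, IsRademacher P (ε i))
    (hε_indep : iIndepFun ε P)
    (hε_indep_ab : IndepFun (fun ω i => ε i ω) (fun ω i => (a i ω, b i ω)) P)
    {τ : ℝ} (hτ : 0 < τ) {δ : ℝ} (hδ₀ : 0 < δ) (hδ₁ : δ < 1)
    {ι : Type*} [Finite ι] [Nonempty ι] (K : ι → ↥(T \ {0})) :
    P.real {ω | ∃ h, (1 / (n : ℝ)) *
        ∑ i, ‖star (a i ω) ⬝ᵥ ((K h).1 *ᵥ b i ω)‖ / ‖(K h).1‖ <
      τ * smallBallProb P a₀ b₀ τ T - Real.pi * rademacherComplexity P a b ε T / √(n : ℝ)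
        - τ * √(Real.log (1 / δ) / (n : ℝ))} ≤ δ := by
  have hn' : (0 : ℝ) < n := by exact_mod_cast hn
  have hsn : (√(n : ℝ)) ^ 2 = n := Real.sq_sqrt hn'.le
  have hsn' : 0 < √(n : ℝ) := Real.sqrt_pos.2 hn'
  have hw : ∀ i, Measurable fun ω => (a i ω, b i ω) := fun i => (ha_meas i).prodMk (hb_meas i)
  have hw₀ : Measurable fun ω => (a₀ ω, b₀ ω) := ha₀_meas.prodMk hb₀_meas
  set μ := P.map fun ω => (a₀ ω, b₀ ω) with hμ
  have : IsProbabilityMeasure μ := Measure.isProbabilityMeasure_map hw₀.aemeasurable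
  have hlaw : ∀ i, P.map (fun ω => (a i ω, b i ω)) = μ := fun i => (h_ident i).map_eq
  have henv₀ : Integrable (fun ω => envelope (a₀ ω, b₀ ω)) P :=
    integrable_envelope ha_iso.1 hb_iso.1
  have henvm : Measurable (envelope : (Fin d₁ → ℂ) × (Fin d₂ → ℂ) → ℝ) := by
    unfold envelope; fun_prop
  have henv : ∀ i, Integrable (fun ω => envelope (a i ω, b i ω)) P := fun i =>
    ((h_ident i).comp henvm).integrable_iff.2 henv₀
  have hwlaw : P.map (fun ω i => (a i ω, b i ω)) = Measure.pi fun _ => μ := by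
    rw [(iIndepFun_iff_map_fun_eq_pi_map fun i => (hw i).aemeasurable).1 h_indep]
    simp_rw [hlaw]
  set f : ι → (Fin d₁ → ℂ) × (Fin d₂ → ℂ) → ℂ := fun h w =>
    measurement (K h).1 w / (τ * ‖(K h).1‖ : ℝ) with hf
  have hfm : ∀ h, Measurable (f h) := fun h => (measurable_measurement _).div_const _
  have hfi : ∀ h, Integrable (f h) μ := fun h =>
    ((integrable_map_measure (measurable_measurement _).aestronglyMeasurable
      hw₀.aemeasurable).2 (integrable_measurement _ ha₀_meas hb₀_meas henv₀)).div_const _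
  have hK : ∀ h, 0 < τ * ‖(K h).1‖ := fun h => mul_pos hτ (norm_pos_of_mem_diff_zero _)
  have hfnorm : ∀ h w, ‖f h w‖ = ‖measurement (K h).1 w‖ / (τ * ‖(K h).1‖) := fun h w => by
    rw [hf, norm_div, Complex.norm_real, Real.norm_of_nonneg (hK h).le]
  have hp : ∀ h, smallBallProb P a₀ b₀ τ T ≤ μ.real {w | 1 ≤ ‖f h w‖} := fun h => by
    refine (smallBallProb_le τ (K h)).trans (le_of_eq ?_)
    simp_rw [hfnorm, one_le_div (hK h)]
    rw [hμ, map_measureReal_apply hw₀ (measurableSet_smallBall _ _)]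
    rfl
  have hD : ∀ u : ℂ, ‖u‖ = 1 → ∑ s : Fin n → Bool,
      ∫ w, ⨆ h, ∑ i, sign (s i) * (u * f h (w i)).re ∂(Measure.pi fun _ => μ) ≤
        2 ^ n * (√n / τ * rademacherComplexity P a b ε T) := fun u hu => by
    rw [integral_iSup_rademacher (t := fun h w => (u * f h w).re) hε_meas hw hε_rad hε_indep
      h_indep hlaw hε_indep_ab (fun h => by fun_prop) fun h => ((hfi h).const_mul u).re]
    exact mul_le_mul_of_nonneg_left (integral_iSup_measurement_le hn hT ha_meas hb_meas hε_meas
      hε_rad henv K hτ hu) (by positivity)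
  refine le_trans (le_of_eq ?_) (measureReal_exists_lt_le hn hfm hfi hp hD hδ₀ hδ₁)
  have hms : MeasurableSet {w : Fin n → (Fin d₁ → ℂ) × (Fin d₂ → ℂ) | ∃ h, ∑ i, ‖f h (w i)‖ <
      n * smallBallProb P a₀ b₀ τ T - Real.pi * (√n / τ * rademacherComplexity P a b ε T) -
        n * √(Real.log (1 / δ) / n)} := by
    simp only [Set.ofPred_exists]
    exact .iUnion fun h => measurableSet_lt (by fun_prop) measurable_const
  rw [← hwlaw, map_measureReal_apply (measurable_pi_lambda _ hw) hms]
  congr 1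
  ext ω
  refine exists_congr fun h => ?_
  have hsum : (1 / (n : ℝ)) * ∑ i, ‖star (a i ω) ⬝ᵥ ((K h).1 *ᵥ b i ω)‖ / ‖(K h).1‖ =
      τ / n * ∑ i, ‖f h (a i ω, b i ω)‖ := by
    simp_rw [hfnorm, Finset.mul_sum]
    refine Finset.sum_congr rfl fun i _ => ?_
    have := norm_pos_of_mem_diff_zero (K h)
    simp only [measurement]
    field_simp
  have hrhs : τ * smallBallProb P a₀ b₀ τ T -
      Real.pi * rademacherComplexity P a b ε T / √(n : ℝ) - τ * √(Real.log (1 / δ) / (n : ℝ)) =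
      τ / n * (n * smallBallProb P a₀ b₀ τ T -
        Real.pi * (√n / τ * rademacherComplexity P a b ε T) - n * √(Real.log (1 / δ) / n)) := by
    have : Real.pi * rademacherComplexity P a b ε T / √(n : ℝ) =
        τ / n * (Real.pi * (√n / τ * rademacherComplexity P a b ε T)) := by
      rw [div_eq_iff hsn'.ne']
      field_simp
      rw [hsn]
    rw [this]
    field_simp
  rw [hsum, hrhs]
  exact mul_lt_mul_iff_right₀ (div_pos hτ hn')

end FiniteFamily

end RankOneSketch

/-! ### Passage to the whole set -/

theorem mainTheorem6 {Ω : Type*} [MeasurableSpace Ω] (P : Measure Ω) [IsProbabilityMeasure P]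
    {d₁ d₂ n : ℕ} (hn : 0 < n)
    (T : Set (Matrix (Fin d₁) (Fin d₂) ℂ))
    (hT : ∀ c : ℂ, ‖c‖ = 1 → ∀ H ∈ T, c • H ∈ T)
    (a₀ : Ω → Fin d₁ → ℂ) (b₀ : Ω → Fin d₂ → ℂ)
    (a : Fin n → Ω → Fin d₁ → ℂ) (b : Fin n → Ω → Fin d₂ → ℂ) (ε : Fin n → Ω → ℝ)
    (ha₀_meas : Measurable a₀) (hb₀_meas : Measurable b₀)
    (ha_meas : ∀ i, Measurable (a i)) (hb_meas : ∀ i, Measurable (b i))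
    (hε_meas : ∀ i, Measurable (ε i))
    (ha_iso : RankOneSketch.IsIsotropic P a₀) (hb_iso : RankOneSketch.IsIsotropic P b₀)
    (h_indep : iIndepFun (fun i ω => (a i ω, b i ω)) P)
    (h_ident : ∀ i, IdentDistrib (fun ω => (a i ω, b i ω)) (fun ω => (a₀ ω, b₀ ω)) P P)
    (hε_rad : ∀ i, RankOneSketch.IsRademacher P (ε i))
    (hε_indep : iIndepFun ε P)
    (hε_indep_ab : IndepFun (fun ω i => ε i ω) (fun ω i => (a i ω, b i ω)) P)
    (τ : ℝ) (hτ : 0 < τ) (δ : ℝ) (hδ₀ : 0 < δ) (hδ₁ : δ < 1) :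
    P.real {ω | (⨅ H : ↥(T \ {0}),
          (1 / (n : ℝ)) * ∑ i, ‖star (a i ω) ⬝ᵥ (H.1 *ᵥ b i ω)‖ / ‖H.1‖) ≥
        τ * RankOneSketch.smallBallProb P a₀ b₀ τ T
          - Real.pi * RankOneSketch.rademacherComplexity P a b ε T / √(n : ℝ)
          - τ * √(Real.log (1 / δ) / (n : ℝ))} ≥ 1 - δ := by
  have hlog : 0 ≤ τ * √(Real.log (1 / δ) / (n : ℝ)) := by positivity
  -- Over an empty index all real infima and suprema are 0, so the right-hand side is nonpositive
  -- and the event is everything.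
  rcases isEmpty_or_nonempty ↥(T \ {0}) with hempty | hne
  · have : ∀ ω, (⨅ H : ↥(T \ {0}),
          (1 / (n : ℝ)) * ∑ i, ‖star (a i ω) ⬝ᵥ (H.1 *ᵥ b i ω)‖ / ‖H.1‖) = 0 := fun ω =>
      Real.iInf_of_isEmpty _
    simp only [this, RankOneSketch.smallBallProb, RankOneSketch.rademacherComplexity,
      Real.iInf_of_isEmpty, Real.iSup_of_isEmpty, integral_zero, mul_zero, zero_div, sub_zero,
      zero_sub, ge_iff_le, neg_nonpos, hlog, Set.ofPred_true, probReal_univ]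
    linarith
  set c := τ * RankOneSketch.smallBallProb P a₀ b₀ τ T
    - Real.pi * RankOneSketch.rademacherComplexity P a b ε T / √(n : ℝ)
    - τ * √(Real.log (1 / δ) / (n : ℝ)) with hc
  obtain ⟨S, hSc, hSd⟩ := RankOneSketch.exists_countable_dense_diff_zero T
  obtain ⟨e, he⟩ := hSc.exists_eq_range hSd.nonempty
  -- Failure at one of the first `N + 1` points of a dense sequence; `N + 1` keeps the family
  -- nonempty.
  set A : ℕ → Set Ω := fun N => {ω | ∃ h : Fin (N + 1), (1 / (n : ℝ)) *
    ∑ i, ‖star (a i ω) ⬝ᵥ ((e h).1 *ᵥ b i ω)‖ / ‖(e h).1‖ < c} with hA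
  have hAmono : Monotone A := fun N M hNM ω ⟨h, hh⟩ => ⟨Fin.castLE (by omega) h, hh⟩
  have hAle : ∀ N, P.real (A N) ≤ δ := fun N =>
    RankOneSketch.measureReal_exists_measurement_lt_le hn hT ha₀_meas hb₀_meas ha_meas hb_meas
      hε_meas ha_iso hb_iso h_indep h_ident hε_rad hε_indep hε_indep_ab hτ hδ₀ hδ₁
      fun h : Fin (N + 1) => e h
  have hbad := RankOneSketch.measureReal_iUnion_le_of_monotone hAmono hAle
  -- Off all `A N` the bound holds on a dense set, hence everywhere, being a closed condition in
  -- `H`. Covering plus subadditivity avoids any measurability claim about the infimum.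
  have hcover : {ω | (⨅ H : ↥(T \ {0}),
      (1 / (n : ℝ)) * ∑ i, ‖star (a i ω) ⬝ᵥ (H.1 *ᵥ b i ω)‖ / ‖H.1‖) ≥ c} ∪ ⋃ N, A N =
      Set.univ := by
    refine Set.eq_univ_of_forall fun ω => ?_
    rw [Set.mem_union, or_iff_not_imp_right]
    intro hω
    have hcont : Continuous fun H : ↥(T \ {0}) =>
        (1 / (n : ℝ)) * ∑ i, ‖star (a i ω) ⬝ᵥ (H.1 *ᵥ b i ω)‖ / ‖H.1‖ :=
      continuous_const.mul (continuous_finsetSum _ fun i _ =>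
        RankOneSketch.continuous_norm_measurement_div T (a i ω, b i ω))
    change c ≤ ⨅ H : ↥(T \ {0}), (1 / (n : ℝ)) * ∑ i, ‖star (a i ω) ⬝ᵥ (H.1 *ᵥ b i ω)‖ / ‖H.1‖
    refine le_ciInf fun H => ?_
    refine hSd.induction (P := fun H : ↥(T \ {0}) => c ≤ (1 / (n : ℝ)) *
      ∑ i, ‖star (a i ω) ⬝ᵥ (H.1 *ᵥ b i ω)‖ / ‖H.1‖) (fun H hH => ?_)
      (isClosed_le continuous_const hcont) H
    obtain ⟨N, rfl⟩ := he ▸ hH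
    by_contra! hlt
    exact hω (Set.mem_iUnion.2 ⟨N, Fin.last N, hlt⟩)
  have h1 := measureReal_union_le (μ := P) {ω | (⨅ H : ↥(T \ {0}),
      (1 / (n : ℝ)) * ∑ i, ‖star (a i ω) ⬝ᵥ (H.1 *ᵥ b i ω)‖ / ‖H.1‖) ≥ c} (⋃ N, A N)
  rw [hcover, probReal_univ] at h1
  linarith
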